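/- Let $\mathbb{L}$ be the Lazard ring, $F_{\mathbb L}(u,v)=u+v+\sum_{i,j\ge1}a_{i,j}u^iv^j\in\mathbb L[[u,v]]$ the universal commutative one-dimensional formal group law, $u\boxplus v=F_{\mathbb L}(u,v)$ the formal sum and $\overline{u}$ the formal inverse, i.e. the power series in $u$ without constant term with $u\boxplus\overline{u}=0$. Let $b=(b_1,b_2,\dots)$ be infinitely many variables, $\mathbb L[[b]]$ the formal power series ring in them, $n\ge 0$ an integer, and $x_n=(x_1,\dots,x_n)$. Let $\Lambda^{\mathbb L}(x_n|b)=\mathbb L[[b]]\,\hat\otimes_{\mathbb L}\,\mathbb L[[e_1(x_n),\dots,e_n(x_n)]]$ be the ring of formal power series in $x_1,\dots,x_n$ with coefficients in $\mathbb L[[b]]$ that are symmetric in $x_1,\dots,x_n$, and let $\mathcal P_n$ be the set of partitions $\lambda=(\lambda_1\ge\dots\ge\lambda_n\ge0)$ of length $\le n$. Put $[t|b]^k=\prod_{j=1}^k(t\boxplus b_j)$. (0) For $i\neq j$ the series $x_i\boxplus\overline{x}_j$ is a non-zero-divisor of $\mathbb L[[b]][[x_n]]$, and for $\lambda\in\mathcal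 P_n$ the sum $$s^{\mathbb L}_\lambda(x_n|b)=\sum_{w\in S_n}w\left[\frac{\prod_{i=1}^n[x_i|b]^{\lambda_i+n-i}}{\prod_{1\le i<j\le n}(x_i\boxplus\overline{x}_j)}\right]$$ ($S_n$ permuting the $x_i$ and fixing the $b_j$), formed in the total ring of fractions, is an element of $\mathbb L[[b]][[x_n]]$; it is called the universal factorial Schur function. (1) (Basis Theorem) The functions $s^{\mathbb L}_\lambda(x_n|b)$, $\lambda\in\mathcal P_n$, form a formal $\mathbb L[[b]]$-basis of $\Lambda^{\mathbb L}(x_n|b)$. That is: they belong to $\Lambda^{\mathbb L}(x_n|b)$; for every family $(c_\lambda)_{\lambda\in\mathcal P_n}$ in $\mathbb L[[b]]$ the formal sum $\sum_\lambda c_\lambda s^{\mathbb L}_\lambda(x_n|b)$ exists (each monomial in $x,b$ occurs in only finitely many summands) and lies in $\Lambda^{\mathbb L}(x_n|b)$; and every element of $\Lambda^{\mathbb L}(x_n|b)$ is such a sum for exactly one family $(c_\lambda)$. (2) For $\mu\in\mathcal P_n$ let $I_\mu=\{\mu_i+n-i+1:1\le i\le n\}$, and let $\Psi^{(n)}$ (the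 GKM ring) be the ring of all families $\psi\in\prod_{\mu\in\mathcal P_n}\mathbb L[[b]]$ such that $b_i\boxplus\overline{b}_j$ divides $\psi_\nu-\psi_\mu$ in $\mathbb L[[b]]$ whenever $1\le i<j$ and $\mu,\nu\in\mathcal P_n$ satisfy $I_\nu=(i\ j)I_\mu$ for the transposition $(i\ j)$. Then the image of the algebraic localization map $$\Lambda^{\mathbb L}(x_n|b)\to\prod_{\mu\in\mathcal P_n}\mathbb L[[b]],\qquad F\mapsto\bigl(F(\overline{b}_{\mu_1+n},\overline{b}_{\mu_2+n-1},\dots,\overline{b}_{\mu_n+1}\,|\,b)\bigr)_{\mu\in\mathcal P_n}$$ is exactly $\Psi^{(n)}$. -/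

import Mathlib

noncomputable section

namespace UniversalSchur

open MvPowerSeries

/-- The polynomial ring `ℤ[a_{i,j} : i, j ≥ 1]`; the variable `(i, j)` stands for
`a_{i+1,j+1}`. -/
abbrev CoeffRing : Type := MvPolynomial (ℕ × ℕ) ℤ

/-- The series `u + v + ∑_{i,j ≥ 1} a_{i,j} u^i v^j` with indeterminate coefficients. -/
def genericSeries : MvPowerSeries (Fin 2) CoeffRing := fun d =>
  if d 0 = 0 then (if d 1 = 1 then 1 else 0)
  else if d 1 = 0 then (if d 0 = 1 then 1 else 0)
  else MvPolynomial.X (d 0 - 1, d 1 - 1)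

/-- `G(G(u, v), w) - G(u, G(v, w))` for the generic series `G`. -/
def assocDefect : MvPowerSeries (Fin 3) CoeffRing :=
  genericSeries.subst ![genericSeries.subst
      ![(X 0 : MvPowerSeries (Fin 3) CoeffRing), X 1], X 2] -
    genericSeries.subst ![(X 0 : MvPowerSeries (Fin 3) CoeffRing),
      genericSeries.subst ![(X 1 : MvPowerSeries (Fin 3) CoeffRing), X 2]]

/-- `G(u, v) - G(v, u)` for the generic series `G`. -/
def commDefect : MvPowerSeries (Fin 2) CoeffRing :=
  genericSeries - genericSeries.subst ![(X 1 : MvPowerSeries (Fin 2) CoeffRing), X 0]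

/-- The ideal of relations that force `G` to be a commutative formal group law. -/
def lazardIdeal : Ideal CoeffRing :=
  Ideal.span (Set.range (fun d => coeff d assocDefect) ∪ Set.range (fun d => coeff d commDefect))

/-- The Lazard ring `𝕃`. -/
def LazardRing : Type := CoeffRing ⧸ lazardIdeal

instance : CommRing LazardRing := inferInstanceAs (CommRing (CoeffRing ⧸ lazardIdeal))

/-- The quotient map `ℤ[a_{i,j}] → 𝕃`. -/
def lazardMk : CoeffRing →+* LazardRing := Ideal.Quotient.mk lazardIdeal

theorem lazardMk_eq_zero {p : CoeffRing} (h : p ∈ lazardIdeal) : lazardMk p = 0 :=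
  Ideal.Quotient.eq_zero_iff_mem.2 h

theorem coeff_genericSeries (d : Fin 2 →₀ ℕ) : coeff d genericSeries =
    if d 0 = 0 then (if d 1 = 1 then 1 else 0)
    else if d 1 = 0 then (if d 0 = 1 then 1 else 0)
    else MvPolynomial.X (d 0 - 1, d 1 - 1) := rfl

theorem constantCoeff_genericSeries : constantCoeff genericSeries = 0 := by
  rw [← coeff_zero_eq_constantCoeff_apply, coeff_genericSeries]; simp

/-- The universal formal group law `F_𝕃` over the Lazard ring. -/
def universalFGL : FormalGroup LazardRing where
  toPowerSeries := genericSeries.map lazardMk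
  zero_constantCoeff := by simp [constantCoeff_map, constantCoeff_genericSeries]
  lin_coeff_X := by simp [coeff_genericSeries]
  lin_coeff_Y := by simp [coeff_genericSeries]
  assoc := by
    have hd : MvPowerSeries.map lazardMk assocDefect = 0 := by
      ext d
      rw [coeff_map, map_zero]
      exact lazardMk_eq_zero (Ideal.subset_span (Or.inl ⟨d, rfl⟩))
    have key (g₁ g₂ : MvPowerSeries (Fin 3) CoeffRing) : ![g₁.map lazardMk, g₂.map lazardMk] =
        fun i => (![g₁, g₂] i).map lazardMk := by ext1 i; fin_cases i <;> simp
    rw [assocDefect, map_sub, sub_eq_zero] at hd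
    simp_rw [(map_X lazardMk _).symm, key, ← map_subst .X_X, key, ← map_subst
      (HasSubst.cons_subst_zero_left (0 : Fin 3) 1 2 constantCoeff_genericSeries), hd,
      ← map_subst (HasSubst.cons_subst_zero_right (0 : Fin 3) 1 2 constantCoeff_genericSeries)]

/-- `F(0, v) = v`, read off on coefficients. -/
theorem coeff_of_left_zero {R : Type*} [CommRing R] (F : FormalGroup R) (d : Fin 2 →₀ ℕ)
    (h0 : d 0 = 0) : coeff d F.toPowerSeries = if d 1 = 1 then 1 else 0 := by
  have h := congrArg (PowerSeries.coeff (d 1)) F.zeroX_eq_X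
  rw [PowerSeries.coeff_X] at h
  rw [← h, FormalGroup.zeroX, PowerSeries.coeff, PowerSeries.X, coeff_subst HasSubst.zero_X,
    finsum_eq_single _ d]
  · simp [Finsupp.prod_fintype, h0, coeff_X_pow]
  · intro e he
    by_cases he0 : e 0 = 0
    · have : e 1 ≠ d 1 := by
        intro h1; apply he; ext i; fin_cases i <;> simp [h0, he0, h1]
      simp [Finsupp.prod_fintype, he0, coeff_X_pow]
      grind
    · simp [Finsupp.prod_fintype, he0]

theorem hasSubst_X_of_zero {R : Type*} [CommRing R] {y : PowerSeries R}
    (hy : PowerSeries.constantCoeff y = 0) :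
    HasSubst ![(PowerSeries.X : PowerSeries R), y] := by
  apply hasSubst_of_constantCoeff_zero
  intro s
  fin_cases s
  · exact PowerSeries.constantCoeff_X
  · exact hy

theorem X_pow_dvd_subst_sub {R : Type*} [CommRing R] (K : MvPowerSeries (Fin 2) R)
    {y z : PowerSeries R} (hy : PowerSeries.constantCoeff y = 0)
    (hz : PowerSeries.constantCoeff z = 0) (n : ℕ) (h : (PowerSeries.X : PowerSeries R) ^ n ∣ y - z) :
    (PowerSeries.X : PowerSeries R) ^ n ∣
      (K.subst ![(PowerSeries.X : PowerSeries R), y] -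
        K.subst ![(PowerSeries.X : PowerSeries R), z] : PowerSeries R) := by
  rw [PowerSeries.X_pow_dvd_iff]
  intro m hm
  rw [map_sub, sub_eq_zero]
  unfold PowerSeries.coeff
  rw [coeff_subst (hasSubst_X_of_zero hy), coeff_subst (hasSubst_X_of_zero hz)]
  refine finsum_congr fun d => ?_
  congr 1
  have h2 : (PowerSeries.X : PowerSeries R) ^ n ∣
      PowerSeries.X ^ d 0 * y ^ d 1 - PowerSeries.X ^ d 0 * z ^ d 1 := by
    rw [← mul_sub]
    exact ((h.trans (sub_dvd_pow_sub_pow y z (d 1)))).mul_left _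
  have h3 := (PowerSeries.X_pow_dvd_iff.1 h2) m hm
  rw [map_sub, sub_eq_zero] at h3
  simpa [Finsupp.prod_fintype] using h3

/-- Existence of the formal inverse series of a formal group law. -/
theorem exists_inverseSeries {R : Type*} [CommRing R] (F : FormalGroup R) :
    ∃ y : PowerSeries R, PowerSeries.constantCoeff y = 0 ∧
      F.toPowerSeries.subst ![(PowerSeries.X : PowerSeries R), y] = (0 : PowerSeries R) := by
  obtain ⟨K, hK⟩ : (X 0 : MvPowerSeries (Fin 2) R) ∣ F.toPowerSeries - X 1 := by
    rw [X_dvd_iff]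
    intro m hm
    rw [map_sub, coeff_of_left_zero F m hm, coeff_X, sub_eq_zero]
    congr 1
    rw [eq_iff_iff]
    constructor
    · intro h; ext i; fin_cases i <;> simp [h, hm]
    · rintro rfl; simp
  have hF (y : PowerSeries R) (hy : PowerSeries.constantCoeff y = 0) :
      F.toPowerSeries.subst ![(PowerSeries.X : PowerSeries R), y] =
        y + PowerSeries.X * K.subst ![(PowerSeries.X : PowerSeries R), y] := by
    rw [show F.toPowerSeries = X 1 + X 0 * K by rw [← hK]; ring,
      subst_add (hasSubst_X_of_zero hy), subst_mul (hasSubst_X_of_zero hy),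
      subst_X (hasSubst_X_of_zero hy), subst_X (hasSubst_X_of_zero hy)]
    rfl
  let Φ : PowerSeries R → PowerSeries R := fun y =>
    -(PowerSeries.X * K.subst ![(PowerSeries.X : PowerSeries R), y])
  obtain ⟨u, hu_zero, hu⟩ : ∃ u : ℕ → PowerSeries R, u 0 = 0 ∧ ∀ k, u (k + 1) = Φ (u k) :=
    ⟨fun k => Φ^[k] 0, rfl, fun k => Function.iterate_succ_apply' _ _ _⟩
  have hΦ0 (y) : PowerSeries.constantCoeff (Φ y) = 0 := by simp [Φ]
  have hu0 (k) : PowerSeries.constantCoeff (u k) = 0 := by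
    cases k with
    | zero => simp [hu_zero]
    | succ k => rw [hu]; exact hΦ0 _
  have hΦ (y z : PowerSeries R) (hy : PowerSeries.constantCoeff y = 0)
      (hz : PowerSeries.constantCoeff z = 0) (n : ℕ)
      (h : (PowerSeries.X : PowerSeries R) ^ n ∣ y - z) :
      (PowerSeries.X : PowerSeries R) ^ (n + 1) ∣ Φ y - Φ z := by
    obtain ⟨q, hq⟩ := X_pow_dvd_subst_sub K hy hz n h
    refine ⟨-q, ?_⟩
    simp only [Φ]
    rw [pow_succ]
    linear_combination (-PowerSeries.X) * hq
  have hstep (k : ℕ) : (PowerSeries.X : PowerSeries R) ^ k ∣ u (k + 1) - u k := by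
    induction k with
    | zero => simp
    | succ k ih =>
      have h := hΦ _ _ (hu0 (k + 1)) (hu0 k) k ih
      rwa [← hu (k + 1), ← hu k] at h
  have hmono (k j : ℕ) : (PowerSeries.X : PowerSeries R) ^ k ∣ u (k + j) - u k := by
    induction j with
    | zero => simp
    | succ j ih =>
      have : u (k + (j + 1)) - u k = (u (k + j + 1) - u (k + j)) + (u (k + j) - u k) := by
        rw [← add_assoc]; ring
      rw [this]
      exact dvd_add ((pow_dvd_pow _ (Nat.le_add_right k j)).trans (hstep _)) ih
  let y : PowerSeries R := PowerSeries.mk fun n => PowerSeries.coeff n (u (n + 1))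
  have hyu (k : ℕ) : (PowerSeries.X : PowerSeries R) ^ k ∣ y - u k := by
    rw [PowerSeries.X_pow_dvd_iff]
    intro m hm
    obtain ⟨j, rfl⟩ := Nat.exists_eq_add_of_lt hm
    have h := (PowerSeries.X_pow_dvd_iff.1 (hmono (m + 1) j)) m (Nat.lt_succ_self m)
    rw [map_sub, sub_eq_zero] at h ⊢
    rw [show m + j + 1 = m + 1 + j by ring, h]
    simp [y]
  have hy0 : PowerSeries.constantCoeff y = 0 := by
    have h := (PowerSeries.X_pow_dvd_iff.1 (hyu 1)) 0 Nat.zero_lt_one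
    rw [map_sub, sub_eq_zero, PowerSeries.coeff_zero_eq_constantCoeff_apply,
      PowerSeries.coeff_zero_eq_constantCoeff_apply, hu0] at h
    exact h
  have hfix : y = Φ y := by
    rw [← sub_eq_zero]
    ext m
    have h : (PowerSeries.X : PowerSeries R) ^ (m + 1) ∣ y - Φ y := by
      have : y - Φ y = (y - u (m + 1)) - (Φ y - Φ (u m)) := by rw [hu]; ring
      rw [this]
      exact dvd_sub (hyu _) (hΦ _ _ hy0 (hu0 _) _ (hyu m))
    simpa using (PowerSeries.X_pow_dvd_iff.1 h) m (Nat.lt_succ_self m)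
  refine ⟨y, hy0, ?_⟩
  rw [hF y hy0]
  nth_rewrite 1 [hfix]
  simp [Φ]
/-- The formal inverse series `χ` of a formal group law `F`: the (unique) power series without
constant term such that `F(t, χ(t)) = 0`. -/
def inverseSeries {R : Type*} [CommRing R] (F : FormalGroup R) : PowerSeries R :=
  Classical.choose (exists_inverseSeries F)

/-- The formal sum `f ⊞ g = F_𝕃(f, g)` of power series over `𝕃` without constant terms. -/
def formalAdd {σ : Type*} (f g : MvPowerSeries σ LazardRing) : MvPowerSeries σ LazardRing :=
  universalFGL.toPowerSeries.subst ![f, g]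

/-- The formal inverse `χ_𝕃(f)` (written `f` with a bar) of a power series over `𝕃` without
constant term. -/
def formalNeg {σ : Type*} (f : MvPowerSeries σ LazardRing) : MvPowerSeries σ LazardRing :=
  (inverseSeries universalFGL).subst f

/-- `𝕃[[b]]`, power series in `b_1, b_2, …`; the variable with index `k : ℕ` is `b_{k+1}`. -/
abbrev BSeries : Type := MvPowerSeries ℕ LazardRing

/-- Power series over `𝕃` in `x_1, …, x_n` (left summand) and `b_1, b_2, …` (right summand,
where the index `k : ℕ` again stands for `b_{k+1}`), that is `𝕃[[b]][[x_1, …, x_n]]`. -/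
abbrev XBSeries (n : ℕ) : Type := MvPowerSeries (Fin n ⊕ ℕ) LazardRing

/-- The variable `x_{i+1}`. -/
def xVar {n : ℕ} (i : Fin n) : XBSeries n := X (Sum.inl i)

/-- The variable `b_{k+1}`, as a power series in `x` and `b`. -/
def bVar {n : ℕ} (k : ℕ) : XBSeries n := X (Sum.inr k)

/-- The inclusion `𝕃[[b]] → 𝕃[[b]][[x_1, …, x_n]]`, through which `𝕃[[b]]` acts. -/
def bIncl (n : ℕ) : BSeries →ₐ[LazardRing] XBSeries n :=
  rename (Function.Embedding.inr : ℕ ↪ Fin n ⊕ ℕ)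

/-- The action of `w ∈ S_n` on power series: `x_i ↦ x_{w(i)}`, while the `b_k` are fixed. -/
def permX {n : ℕ} (w : Equiv.Perm (Fin n)) : XBSeries n ≃ₐ[LazardRing] XBSeries n :=
  renameEquiv LazardRing (Equiv.sumCongr w (Equiv.refl ℕ))

/-- `Λ^𝕃(x_n|b)`: the ring of power series in `x_1, …, x_n` with coefficients in `𝕃[[b]]` that
are symmetric in `x_1, …, x_n`. -/
def symmetricSeries (n : ℕ) : Subalgebra LazardRing (XBSeries n) where
  carrier := {f | ∀ w : Equiv.Perm (Fin n), permX w f = f}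
  mul_mem' hf hg w := by rw [map_mul, hf w, hg w]
  add_mem' hf hg w := by rw [map_add, hf w, hg w]
  algebraMap_mem' r w := (permX w).commutes r

/-- `𝒫_n`: partitions of length at most `n`, as sequences `λ_1 ≥ … ≥ λ_n ≥ 0`. -/
abbrev Partitions (n : ℕ) : Type := {lam : Fin n → ℕ // Antitone lam}

/-- `[t|b]^k = (t ⊞ b_1) ⋯ (t ⊞ b_k)`. -/
def factorialPow {n : ℕ} (t : XBSeries n) (k : ℕ) : XBSeries n :=
  ∏ j ∈ Finset.range k, formalAdd t (bVar j)

/-- The numerator `[x|b]^{λ + ρ_{n-1}} = ∏_{i=1}^n [x_i|b]^{λ_i + n - i}`. Note that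
`i.rev = n - 1 - i` for `i : Fin n`, the index of `x_{i+1}`. -/
def schurNum {n : ℕ} (lam : Partitions n) : XBSeries n :=
  ∏ i : Fin n, factorialPow (xVar i) (lam.1 i + (i.rev : ℕ))

/-- The denominator: the product over `1 ≤ i < j ≤ n` of the formal differences of `x_i`
and `x_j`. -/
def schurDenom (n : ℕ) : XBSeries n :=
  ∏ i : Fin n, ∏ j ∈ Finset.Ioi i, formalAdd (xVar i) (formalNeg (xVar j))

/-- The sum `∑_{w ∈ S_n} w([x|b]^{λ + ρ_{n-1}} / ∏_{i<j} (…))`, formed in the total ring of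
fractions of `𝕃[[b]][[x_1, …, x_n]]`. -/
def schurFraction {n : ℕ} (lam : Partitions n) : FractionRing (XBSeries n) :=
  ∑ w : Equiv.Perm (Fin n),
    algebraMap (XBSeries n) (FractionRing (XBSeries n)) (permX w (schurNum lam)) *
      Ring.inverse
        (algebraMap (XBSeries n) (FractionRing (XBSeries n)) (permX w (schurDenom n)))

/-- The universal factorial Schur function `s^𝕃_λ(x_n|b)`: the power series equal to the sum
`schurFraction lam` of fractions. -/
def universalFactorialSchur {n : ℕ} (lam : Partitions n) : XBSeries n :=
  Classical.epsilon fun s : XBSeries n =>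
    algebraMap (XBSeries n) (FractionRing (XBSeries n)) s = schurFraction lam

/-- `F` is the formal sum of the family `f`: every monomial occurs in only finitely many `f i`,
and the coefficients of `F` are the sums of the coefficients of the `f i`. -/
def IsFormalSum {ι σ R : Type*} [CommRing R] (f : ι → MvPowerSeries σ R)
    (F : MvPowerSeries σ R) : Prop :=
  ∀ m : σ →₀ ℕ, {i | coeff m (f i) ≠ 0}.Finite ∧ coeff m F = ∑ᶠ i, coeff m (f i)

/-- The family `s` is a formal `𝕃[[b]]`-basis of `Λ^𝕃(x_n|b)`: its members lie in `Λ^𝕃(x_n|b)`,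
all formal (possibly infinite) `𝕃[[b]]`-linear combinations of them exist in `Λ^𝕃(x_n|b)`, and
every element of `Λ^𝕃(x_n|b)` is such a combination with unique coefficients. -/
structure IsFormalBasis {ι : Type*} (n : ℕ) (s : ι → XBSeries n) : Prop where
  mem : ∀ i, s i ∈ symmetricSeries n
  summable : ∀ c : ι → BSeries, ∃ F ∈ symmetricSeries n,
    IsFormalSum (fun i => bIncl n (c i) * s i) F
  existsUnique : ∀ F ∈ symmetricSeries n, ∃! c : ι → BSeries,
    IsFormalSum (fun i => bIncl n (c i) * s i) F

/-- The point at which `μ ∈ 𝒫_n` localizes: `x_i` goes to the formal inverse of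
`b_{μ_i + n - i + 1}`, and every `b_k` goes to itself. -/
def locPoint {n : ℕ} (mu : Partitions n) : Fin n ⊕ ℕ → BSeries :=
  Sum.elim (fun i => formalNeg (X (mu.1 i + (i.rev : ℕ)))) X

theorem constantCoeff_formalNeg_X (k : ℕ) :
    constantCoeff (formalNeg (X k : BSeries)) = 0 :=
  PowerSeries.constantCoeff_subst_eq_zero (constantCoeff_X k) _
    (Classical.choose_spec (exists_inverseSeries universalFGL)).1

theorem hasSubst_locPoint {n : ℕ} (mu : Partitions n) : HasSubst (locPoint mu) := by
  refine ⟨?_, fun d => ?_⟩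
  · rintro (i | k)
    · simp [locPoint, constantCoeff_formalNeg_X]
    · simp [locPoint]
  · have h := (HasSubst.X (σ := ℕ) (S := LazardRing)).coeff_zero d
    refine ((Set.finite_range (Sum.inl : Fin n → Fin n ⊕ ℕ)).union
      (h.image (Sum.inr : ℕ → Fin n ⊕ ℕ))).subset ?_
    rintro (i | k) hk
    · exact Or.inl ⟨i, rfl⟩
    · exact Or.inr ⟨k, hk, rfl⟩

/-- The localization `F ↦ (F(b̄_{μ + ρ_n}|b))_{μ ∈ 𝒫_n}` with values in `∏_{μ} 𝕃[[b]]`; the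
algebraic localization map is its restriction to `Λ^𝕃(x_n|b)`. -/
def localization (n : ℕ) : XBSeries n →ₐ[LazardRing] (Partitions n → BSeries) :=
  AlgHom.pi fun mu => substAlgHom (hasSubst_locPoint mu)

/-- The `n`-element set `{μ_i + n - i + 1 : 1 ≤ i ≤ n}` attached to `μ ∈ 𝒫_n` (shifted by one,
as are the indices of the `b_k`). It is the image of `{1, …, n}` under the Grassmannian
permutation of `μ`, it determines `μ`, and the Weyl group `S_∞` acts on `𝒫_n` through it. -/
def betaSet {n : ℕ} (mu : Partitions n) : Set ℕ :=
  Set.range fun i : Fin n => mu.1 i + (i.rev : ℕ)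

/-- The GKM ring of type `A_∞`: for every positive root `α = t_j - t_i` with `j > i`, and all
`μ, ν ∈ 𝒫_n` with `ν = s_α μ`, the element `e(-α)`, the formal sum of `b_i` and the formal
inverse of `b_j`, divides `ψ_ν - ψ_μ`. -/
def gkmRing (n : ℕ) : Subring (Partitions n → BSeries) where
  carrier := {psi | ∀ i j : ℕ, i < j → ∀ mu nu : Partitions n,
    betaSet nu = Equiv.swap i j '' betaSet mu →
      formalAdd (X i) (formalNeg (X j)) ∣ psi nu - psi mu}
  mul_mem' := by
    intro f g hf hg i j hij mu nu h
    have : (f * g) nu - (f * g) mu = (f nu - f mu) * g nu + f mu * (g nu - g mu) := by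
      simp only [Pi.mul_apply]; ring
    rw [this]
    exact dvd_add ((hf i j hij mu nu h).mul_right _) ((hg i j hij mu nu h).mul_left _)
  one_mem' := by intro i j _ mu nu _; simp
  add_mem' := by
    intro f g hf hg i j hij mu nu h
    have : (f + g) nu - (f + g) mu = (f nu - f mu) + (g nu - g mu) := by
      simp only [Pi.add_apply]; ring
    rw [this]
    exact dvd_add (hf i j hij mu nu h) (hg i j hij mu nu h)
  zero_mem' := by intro i j _ mu nu _; simp
  neg_mem' := by
    intro f hf i j hij mu nu h
    have : (-f) nu - (-f) mu = -(f nu - f mu) := by simp only [Pi.neg_apply]; ring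
    rw [this]
    exact (hf i j hij mu nu h).neg_right

end UniversalSchur

end

/-! For series `f`, `g` without constant term, the formal difference of `f` and `g` is a unit times
`f - g`, because the linear part of a formal group law is `u + v`. Hence every formal difference, in
denominators, values and root divisibilities, can be replaced by an ordinary difference of
variables. Such differences are regular over any coefficient ring, so nothing is needed about the
Lazard ring itself, not even that it is a domain.

The Schur denominator becomes a unit times the Vandermonde determinant, and the sum over `S_n`
becomes an alternating series divided by that determinant. Merging two `x`-variables kills an
alternating series, so the quotient is a symmetric power series (`vandermondeX_dvd_alternation`). It
has order at least `|λ|`, which makes all formal combinations converge.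

Evaluation at the localization points is triangular: `s_λ` vanishes at `μ` unless `λ ⊆ μ`, and its
value at `λ` is a unit times a product of differences of `b`-variables indexed by the inversions of
`λ`, hence regular. Each inversion comes from a reflection to a smaller partition. So the GKM
congruences force a family that vanishes at all smaller partitions to be divisible at `λ` by this
diagonal value (`evalAt_self_dvd`). Elimination by increasing size then writes every GKM family as
the localization of a formal combination of the `s_λ`.

Symmetric series localize into the GKM ring, and localization is injective on them because there are
infinitely many `b_k` (`eq_zero_of_evalAt_eq_zero`). Expanding the localization of a symmetric
series therefore expands the series itself; triangularity makes the coefficients unique. -/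

noncomputable section

namespace UniversalSchur

open MvPowerSeries

/-! ### Power series over a commutative ring: divided differences, specialization, regular
differences -/

section General

variable {σ τ R : Type*} [CommRing R]

theorem coeff_X_mul_ite (s : σ) (f : MvPowerSeries σ R) (m : σ →₀ ℕ) :
    coeff m (X s * f) = if m s = 0 then 0 else coeff (m - Finsupp.single s 1) f := by
  rw [X_def, coeff_monomial_mul, one_mul]
  by_cases h : m s = 0
  · rw [if_pos h, if_neg]
    intro h1
    have := h1 s
    simp [h] at this
  · rw [if_neg h, if_pos]
    simpa [Finsupp.single_le_iff] using Nat.one_le_iff_ne_zero.2 h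

open Classical in
/-- The embedding `σ → Option σ` that sends `s` to `none` and every other `t` to `some t`. -/
def swapNone (s : σ) : σ ↪ Option σ where
  toFun t := if t = s then none else some t
  inj' a b h := by
    simp only at h
    split_ifs at h with h1 h2 h2
    · rw [h1, h2]
    · exact Option.some_injective _ h

theorem swapNone_self (s : σ) : swapNone s s = none := if_pos rfl

theorem swapNone_of_ne {s t : σ} (h : t ≠ s) : swapNone s t = some t := if_neg h

theorem some_notMem_range_swapNone (s : σ) : some s ∉ Set.range (swapNone s) := by
  rintro ⟨u, hu⟩
  by_cases h : u = s
  · simp [h, swapNone_self] at hu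
  · rw [swapNone_of_ne h] at hu
    exact h (Option.some_injective _ hu)

theorem coeff_rename_some (f : MvPowerSeries σ R) (m : Option σ →₀ ℕ) :
    coeff m (rename (Function.Embedding.some : σ ↪ Option σ) f) =
      if m none = 0 then coeff m.some f else 0 := by
  split_ifs with h
  · rw [← coeff_embDomain_rename Function.Embedding.some f]
    congr 2
    ext t
    cases t with
    | none => rw [h, Finsupp.embDomain_of_notMem_range]; simp
    | some t =>
      exact (Finsupp.embDomain_apply_self Function.Embedding.some m.some t).symm
  · apply coeff_rename_eq_zero
    rintro ⟨m', rfl⟩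
    apply h
    rw [← Finsupp.embDomain_eq_mapDomain, Finsupp.embDomain_of_notMem_range]
    simp

theorem coeff_rename_swapNone (s : σ) (f : MvPowerSeries σ R) (m : Option σ →₀ ℕ) :
    coeff m (rename (swapNone s) f) =
      if m (some s) = 0 then coeff (m.some + Finsupp.single s (m none)) f else 0 := by
  split_ifs with h
  · rw [← coeff_embDomain_rename (swapNone s) f]
    congr 2
    ext t
    have key (t : σ) := Finsupp.embDomain_apply_self (swapNone s)
      (m.some + Finsupp.single s (m none)) t
    cases t with
    | none =>
      have := key s
      rw [swapNone_self] at this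
      rw [this]
      simp [h]
    | some t =>
      by_cases hts : t = s
      · subst hts
        rw [h, Finsupp.embDomain_of_notMem_range _ _ _ (some_notMem_range_swapNone t)]
      · have := key t
        rw [swapNone_of_ne hts] at this
        rw [this]
        simp [Ne.symm hts]
  · apply coeff_rename_eq_zero
    rintro ⟨m', rfl⟩
    apply h
    rw [← Finsupp.embDomain_eq_mapDomain,
      Finsupp.embDomain_of_notMem_range _ _ _ (some_notMem_range_swapNone s)]

/-- The divided difference of `f` with respect to `X s` and a new variable. -/
def dividedDifference (s : σ) (f : MvPowerSeries σ R) : MvPowerSeries (Option σ) R :=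
  fun m => coeff (m.some + Finsupp.single s (m none + 1)) f

theorem coeff_dividedDifference (s : σ) (f : MvPowerSeries σ R) (m : Option σ →₀ ℕ) :
    coeff m (dividedDifference s f) = coeff (m.some + Finsupp.single s (m none + 1)) f := rfl

theorem constantCoeff_dividedDifference (s : σ) (f : MvPowerSeries σ R) :
    constantCoeff (dividedDifference s f) = coeff (Finsupp.single s 1) f := by
  rw [← coeff_zero_eq_constantCoeff_apply, coeff_dividedDifference]
  congr 2
  ext t
  simp

/-- With `x = X (some s)` and `y = X none`, this is `x^k - y^k = (x - y) ∑ x^a y^c` over `a + c + 1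
= k`, applied to each power of the variable `s`. -/
theorem rename_sub_rename (s : σ) (f : MvPowerSeries σ R) :
    rename (Function.Embedding.some : σ ↪ Option σ) f - rename (swapNone s) f =
      (X (some s) - X none) * dividedDifference s f := by
  ext m
  rw [map_sub, coeff_rename_some, coeff_rename_swapNone, sub_mul, map_sub, coeff_X_mul_ite,
    coeff_X_mul_ite, coeff_dividedDifference, coeff_dividedDifference]
  have h1 (h : m (some s) ≠ 0) : (m - Finsupp.single (some s) 1).some +
      Finsupp.single s ((m - Finsupp.single (some s) 1 : Option σ →₀ ℕ) none + 1) =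
      m.some + Finsupp.single s (m none) := by
    classical
    ext t
    by_cases hts : s = t
    · subst hts; simp; omega
    · simp [hts]
  have h2 (h : m none ≠ 0) : (m - Finsupp.single none 1).some +
      Finsupp.single s ((m - Finsupp.single none 1 : Option σ →₀ ℕ) none + 1) =
      m.some + Finsupp.single s (m none) := by
    classical
    ext t
    by_cases hts : s = t
    · subst hts; simp; omega
    · simp [hts]
  by_cases ha : m (some s) = 0 <;> by_cases hb : m none = 0
  · simp [ha, hb]
  · rw [h2 hb]; simp [ha, hb]
  · rw [h1 ha]; simp [ha, hb]
  · rw [h2 hb, h1 ha]; simp [ha, hb]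

theorem constantCoeff_subst_of_zero {a : σ → MvPowerSeries τ R} (ha : HasSubst a)
    (h0 : ∀ i, constantCoeff (a i) = 0) (f : MvPowerSeries σ R) :
    constantCoeff (f.subst a) = constantCoeff f := by
  have h := constantCoeff_subst_eq_zero ha h0 (f := f - C (constantCoeff f)) (by simp)
  rw [subst_sub ha, map_sub, sub_eq_zero] at h
  rw [h, subst_C, constantCoeff_C]

/-- If `a` and `a'` differ only in the variable `s`, then `f(a) - f(a')` is a multiple of
`a s - a' s`. -/
theorem exists_subst_sub_subst {a a' : σ → MvPowerSeries τ R} (ha : HasSubst a)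
    (h0 : ∀ i, constantCoeff (a i) = 0) (h0' : ∀ i, constantCoeff (a' i) = 0) (s : σ)
    (h : ∀ t, t ≠ s → a t = a' t) (f : MvPowerSeries σ R) :
    ∃ q, f.subst a - f.subst a' = (a s - a' s) * q ∧
      constantCoeff q = coeff (Finsupp.single s 1) f := by
  -- One point carries both values of the variable `s`: `some s` receives `a s` and the extra
  -- variable `none` receives `a' s`.
  let b : Option σ → MvPowerSeries τ R := fun o => o.elim (a' s) a
  have hb0 : ∀ i, constantCoeff (b i) = 0 := by
    rintro (_ | t)
    · exact h0' s
    · exact h0 t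
  have hb : HasSubst b := by
    refine ⟨fun i => by rw [hb0]; exact IsNilpotent.zero, fun d => ?_⟩
    refine ((Set.finite_singleton none).union ((ha.coeff_zero d).image some)).subset ?_
    rintro (_ | t) ht
    · exact Or.inl rfl
    · exact Or.inr ⟨t, ht, rfl⟩
  have h1 : (rename (Function.Embedding.some : σ ↪ Option σ) f).subst b = f.subst a := by
    rw [rename_eq_subst, subst_comp_subst_apply (HasSubst.X_comp _) hb]
    congr 1
    ext1 t
    simp only [Function.comp_apply]
    rw [subst_X hb]
    rfl
  have h2 : (rename (swapNone s) f).subst b = f.subst a' := by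
    rw [rename_eq_subst, subst_comp_subst_apply (HasSubst.X_comp _) hb]
    congr 1
    ext1 t
    simp only [Function.comp_apply]
    rw [subst_X hb]
    by_cases hts : t = s
    · subst hts; simp [swapNone_self, b]
    · simp [swapNone_of_ne hts, b, h t hts]
  refine ⟨(dividedDifference s f).subst b, ?_, ?_⟩
  · rw [← h1, ← h2, ← subst_sub hb, rename_sub_rename, subst_mul hb, subst_sub hb, subst_X hb,
      subst_X hb]
    rfl
  · rw [constantCoeff_subst_of_zero hb hb0, constantCoeff_dividedDifference]

theorem order_le_order_subst {a : σ → MvPowerSeries τ R} (ha : HasSubst a)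
    (h0 : ∀ i, constantCoeff (a i) = 0) (f : MvPowerSeries σ R) :
    f.order ≤ (f.subst a).order := by
  refine le_trans ?_ (le_order_subst ha f)
  have : 1 ≤ ⨅ i, (a i).order := le_iInf fun i => one_le_order_iff_constCoeff_eq_zero.2 (h0 i)
  calc f.order = 1 * f.order := (one_mul _).symm
    _ ≤ _ := by gcongr

open Classical in
theorem hasSubst_update (s : σ) {a : MvPowerSeries σ R} (ha : constantCoeff a = 0) :
    HasSubst (Function.update X s a) := by
  refine ⟨fun t => ?_, fun d => ?_⟩
  · by_cases h : t = s
    · subst h; simp [ha]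
    · simp [h]
  · refine ((Set.finite_singleton s).union
      ((HasSubst.X (σ := σ) (S := R)).coeff_zero d)).subset fun t ht => ?_
    by_cases h : t = s
    · exact Or.inl h
    · right
      simpa [h] using ht

open Classical in
/-- The endomorphism of the power series ring with `X s ↦ a` that fixes the other variables. -/
def specialize (s : σ) {a : MvPowerSeries σ R} (ha : constantCoeff a = 0) :
    MvPowerSeries σ R →ₐ[R] MvPowerSeries σ R :=
  substAlgHom (hasSubst_update s ha)

open Classical in
theorem specialize_apply (s : σ) {a : MvPowerSeries σ R} (ha : constantCoeff a = 0)
    (f : MvPowerSeries σ R) : specialize s ha f = f.subst (Function.update X s a) := by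
  rw [specialize, coe_substAlgHom]

theorem specialize_X_self (s : σ) {a : MvPowerSeries σ R} (ha : constantCoeff a = 0) :
    specialize s ha (X s) = a := by
  classical
  rw [specialize_apply, subst_X (hasSubst_update s ha)]; simp

theorem specialize_X_of_ne {s t : σ} {a : MvPowerSeries σ R} (ha : constantCoeff a = 0)
    (h : t ≠ s) : specialize s ha (X t) = X t := by
  classical
  rw [specialize_apply, subst_X (hasSubst_update s ha)]; simp [h]

theorem specialize_X [DecidableEq σ] (s t : σ) {a : MvPowerSeries σ R}
    (ha : constantCoeff a = 0) : specialize s ha (X t) = if t = s then a else X t := by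
  split_ifs with h
  · subst h; exact specialize_X_self t ha
  · exact specialize_X_of_ne ha h

theorem specialize_subst (s : σ) {a : MvPowerSeries σ R} (ha : constantCoeff a = 0)
    {b : τ → MvPowerSeries σ R} (hb : HasSubst b) (f : MvPowerSeries τ R) :
    specialize s ha (f.subst b) = f.subst fun t => specialize s ha (b t) := by
  classical
  simp_rw [specialize_apply]
  exact subst_comp_subst_apply hb (hasSubst_update s ha) f

theorem specialize_eq_subst (s : σ) {a : MvPowerSeries σ R} (ha : constantCoeff a = 0)
    (f : MvPowerSeries σ R) :
    specialize s ha f = f.subst fun t => specialize s ha (X t) := by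
  rw [← specialize_subst s ha HasSubst.X, subst_self, id]

/-- The factor theorem: `f` differs from its specialization by a multiple of `X s - a`. -/
theorem dvd_of_specialize_eq_zero (s : σ) {a : MvPowerSeries σ R} (ha : constantCoeff a = 0)
    {f : MvPowerSeries σ R} (h : specialize s ha f = 0) : X s - a ∣ f := by
  classical
  obtain ⟨q, hq, -⟩ := exists_subst_sub_subst (a := X) (a' := Function.update X s a)
    HasSubst.X (fun i => constantCoeff_X i)
    (fun t => by by_cases h : t = s <;> [(subst h; simp [ha]); simp [h]]) s
    (fun t ht => by simp [ht]) f
  rw [← specialize_apply s ha, h, subst_self, sub_zero] at hq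
  exact ⟨q, by simpa using hq⟩

/-- The coefficient of the product at `m + t` is the coefficient of `f` at `m - s + t` (zero if `s`
does not occur in `m`) minus the one at `m`. Induction on the exponent of `s` therefore kills all
low coefficients of `f`, with no assumption on `R`. -/
theorem le_order_of_mul_X_sub_X {s t : σ} (hst : s ≠ t) (f : MvPowerSeries σ R) (N : ℕ)
    (h : ((N + 1 : ℕ) : ℕ∞) ≤ ((X s - X t) * f).order) : (N : ℕ∞) ≤ f.order := by
  classical
  apply nat_le_order
  suffices ∀ k, ∀ m : σ →₀ ℕ, m s = k → m.degree < N → coeff m f = 0 from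
    fun m hm => this _ m rfl hm
  intro k
  induction k with
  | zero =>
    intro m hk hm
    have h1 : coeff (m + Finsupp.single t 1) ((X s - X t) * f) = 0 := by
      apply coeff_of_lt_order
      refine lt_of_lt_of_le ?_ h
      rw [map_add, Finsupp.degree_single]
      exact_mod_cast Nat.succ_lt_succ hm
    rw [sub_mul, map_sub, coeff_X_mul_ite, coeff_X_mul_ite] at h1
    simpa [hk, Finsupp.single_apply, hst.symm] using h1
  | succ k ih =>
    intro m hk hm
    have h1 : coeff (m + Finsupp.single t 1) ((X s - X t) * f) = 0 := by
      apply coeff_of_lt_order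
      refine lt_of_lt_of_le ?_ h
      rw [map_add, Finsupp.degree_single]
      exact_mod_cast Nat.succ_lt_succ hm
    have hle : Finsupp.single s 1 ≤ m := by simp [hk]
    obtain ⟨m', rfl⟩ := exists_add_of_le hle
    have h2 := ih (m' + Finsupp.single t 1)
      (by simp [hst.symm] at hk ⊢; omega)
      (by simp [Finsupp.degree_single] at hm ⊢; omega)
    rw [sub_mul, map_sub, coeff_X_mul_ite, coeff_X_mul_ite] at h1
    rw [add_tsub_cancel_right, add_assoc, add_tsub_cancel_left, h2] at h1
    simpa using h1

theorem X_sub_X_mem_nonZeroDivisors {s t : σ} (hst : s ≠ t) :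
    (X s - X t : MvPowerSeries σ R) ∈ nonZeroDivisors (MvPowerSeries σ R) := by
  rw [mem_nonZeroDivisors_iff_right]
  intro f hf
  rw [← order_eq_top_iff, ENat.eq_top_iff_forall_ge]
  intro N
  refine le_order_of_mul_X_sub_X hst f N ?_
  rw [mul_comm, hf, order_zero]
  exact le_top

theorem le_order_of_prod_mul {ι : Type*} (S : Finset ι) (u v : ι → σ) (huv : ∀ i ∈ S, u i ≠ v i)
    (f : MvPowerSeries σ R) (N : ℕ)
    (h : ((N + S.card : ℕ) : ℕ∞) ≤ ((∏ i ∈ S, (X (u i) - X (v i))) * f).order) :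
    (N : ℕ∞) ≤ f.order := by
  classical
  induction S using Finset.induction_on generalizing N with
  | empty => simpa using h
  | insert i S hi ih =>
    rw [Finset.prod_insert hi, mul_assoc, Finset.card_insert_of_notMem hi, ← add_assoc] at h
    exact ih (fun j hj => huv j (Finset.mem_insert_of_mem hj)) N
      (le_order_of_mul_X_sub_X (huv i (Finset.mem_insert_self i S)) _ _ h)

end General

/-- If `p i` generates (at least) the kernel of `φ i`, and `φ i` sends the other `p j` to
non-zero-divisors, then an element that is killed by all `φ i` is divisible by `∏ i, p i`. -/
theorem prod_dvd_of_ringHom {ι A : Type*} [CommRing A] (S : Finset ι) (p : ι → A)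
    (φ : ι → A →+* A) (hker : ∀ i ∈ S, ∀ g, φ i g = 0 → p i ∣ g)
    (hreg : ∀ i ∈ S, ∀ j ∈ S, i ≠ j → φ i (p j) ∈ nonZeroDivisors A) {f : A}
    (hf : ∀ i ∈ S, φ i f = 0) : ∏ i ∈ S, p i ∣ f := by
  classical
  induction S using Finset.induction_on with
  | empty => simp
  | insert i S hi ih =>
    obtain ⟨g, rfl⟩ := ih
      (fun j hj => hker j (Finset.mem_insert_of_mem hj))
      (fun j hj k hk => hreg j (Finset.mem_insert_of_mem hj) k (Finset.mem_insert_of_mem hk))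
      (fun j hj => hf j (Finset.mem_insert_of_mem hj))
    -- Apply `φ i` to the factorization already obtained: the product over `S` maps to a regular
    -- element, so `g` is killed by `φ i` and absorbs the factor `p i`.
    have h := hf i (Finset.mem_insert_self i S)
    rw [map_mul, map_prod] at h
    have hr : ∏ j ∈ S, φ i (p j) ∈ nonZeroDivisors A :=
      Submonoid.prod_mem _ fun j hj => hreg i (Finset.mem_insert_self i S) j
        (Finset.mem_insert_of_mem hj) (fun hij => hi (hij ▸ hj))
    have hg : φ i g = 0 := (mul_left_mem_nonZeroDivisors_eq_zero_iff hr).1 h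
    rw [Finset.prod_insert hi, mul_comm]
    exact mul_dvd_mul_left _ (hker i (Finset.mem_insert_self i S) g hg)

/-! ### Formal differences agree with ordinary differences up to units -/

section FormalGroupLaw

theorem coeff_universalFGL_left :
    coeff (Finsupp.single 0 1) universalFGL.toPowerSeries = (1 : LazardRing) := by
  change coeff _ (genericSeries.map lazardMk) = _
  simp [coeff_genericSeries]

theorem universalFGL_comm :
    universalFGL.toPowerSeries.subst ![(X 1 : MvPowerSeries (Fin 2) LazardRing), X 0] =
      universalFGL.toPowerSeries := by
  have hd : MvPowerSeries.map lazardMk commDefect = 0 := by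
    ext d
    rw [coeff_map, map_zero]
    exact lazardMk_eq_zero (Ideal.subset_span (Or.inr ⟨d, rfl⟩))
  rw [commDefect, map_sub, sub_eq_zero, map_subst .X_X] at hd
  have key : (fun i => (![(X 1 : MvPowerSeries (Fin 2) CoeffRing), X 0] i).map lazardMk) =
      ![(X 1 : MvPowerSeries (Fin 2) LazardRing), X 0] := by
    ext1 i; fin_cases i <;> simp
  rw [key] at hd
  exact hd.symm

variable {σ τ : Type*} {f g h : MvPowerSeries σ LazardRing}

theorem hasSubst_pair (hf : constantCoeff f = 0) (hg : constantCoeff g = 0) :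
    HasSubst ![f, g] := by
  apply hasSubst_of_constantCoeff_zero
  intro i
  fin_cases i <;> simpa

theorem constantCoeff_pair (hf : constantCoeff f = 0) (hg : constantCoeff g = 0) (i : Fin 2) :
    constantCoeff (![f, g] i) = 0 := by
  fin_cases i <;> simpa

theorem constantCoeff_formalAdd (hf : constantCoeff f = 0) (hg : constantCoeff g = 0) :
    constantCoeff (formalAdd f g) = 0 := by
  rw [formalAdd, constantCoeff_subst_of_zero (hasSubst_pair hf hg) (constantCoeff_pair hf hg)]
  exact universalFGL.zero_constantCoeff

theorem constantCoeff_formalNeg (hf : constantCoeff f = 0) : constantCoeff (formalNeg f) = 0 :=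
  PowerSeries.constantCoeff_subst_eq_zero hf _
    (Classical.choose_spec (exists_inverseSeries universalFGL)).1

theorem formalAdd_comm (hf : constantCoeff f = 0) (hg : constantCoeff g = 0) :
    formalAdd f g = formalAdd g f := by
  rw [formalAdd, ← universalFGL_comm, subst_comp_subst_apply .X_X (hasSubst_pair hf hg), formalAdd]
  congr 1
  ext1 i
  fin_cases i
  · exact subst_X (hasSubst_pair hf hg) 1
  · exact subst_X (hasSubst_pair hf hg) 0

theorem subst_formalAdd {a : σ → MvPowerSeries τ LazardRing} (ha : HasSubst a)
    (hf : constantCoeff f = 0) (hg : constantCoeff g = 0) :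
    (formalAdd f g).subst a = formalAdd (f.subst a) (g.subst a) := by
  rw [formalAdd, subst_comp_subst_apply (hasSubst_pair hf hg) ha, formalAdd]
  congr 1
  ext1 i
  fin_cases i <;> rfl

theorem subst_formalNeg {a : σ → MvPowerSeries τ LazardRing} (ha : HasSubst a)
    (hf : constantCoeff f = 0) : (formalNeg f).subst a = formalNeg (f.subst a) := by
  have hf' : HasSubst fun _ : Unit => f := hasSubst_of_constantCoeff_zero fun _ => hf
  rw [formalNeg, PowerSeries.subst, subst_comp_subst_apply hf' ha]
  rfl

theorem formalAdd_formalNeg_self (hf : constantCoeff f = 0) : formalAdd f (formalNeg f) = 0 := by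
  have hf' : HasSubst fun _ : Unit => f := hasSubst_of_constantCoeff_zero fun _ => hf
  have h1 := Classical.choose_spec (exists_inverseSeries universalFGL)
  have h2 := congrArg (PowerSeries.subst f) h1.2
  rw [PowerSeries.subst, PowerSeries.subst,
    subst_comp_subst_apply (hasSubst_X_of_zero h1.1) hf'] at h2
  rw [formalAdd]
  refine Eq.trans ?_ (h2.trans ?_)
  · congr 1
    ext1 i
    fin_cases i
    · exact (subst_X hf' ()).symm
    · rfl
  · rw [← coe_substAlgHom hf']
    exact map_zero _

theorem isUnit_of_constantCoeff_eq_one {q : MvPowerSeries σ LazardRing}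
    (hq : constantCoeff q = 1) : IsUnit q := by
  rw [isUnit_iff_constantCoeff, hq]
  exact isUnit_one

/-- The difference quotient of `F(u, v)` in `u` has constant term equal to the coefficient of `u`,
which is `1`; so it is a unit. -/
theorem associated_formalAdd_sub_left (hf : constantCoeff f = 0) (hg : constantCoeff g = 0)
    (hh : constantCoeff h = 0) : Associated (f - h) (formalAdd f g - formalAdd h g) := by
  obtain ⟨q, hq, hq1⟩ := exists_subst_sub_subst (hasSubst_pair hf hg) (constantCoeff_pair hf hg)
    (constantCoeff_pair hh hg) 0 (fun t ht => by fin_cases t <;> simp_all)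
    universalFGL.toPowerSeries
  rw [coeff_universalFGL_left] at hq1
  exact ⟨(isUnit_of_constantCoeff_eq_one hq1).unit, hq.symm⟩

theorem associated_formalAdd_formalNeg (hf : constantCoeff f = 0) (hg : constantCoeff g = 0) :
    Associated (f - g) (formalAdd f (formalNeg g)) := by
  have h1 := associated_formalAdd_sub_left hf (constantCoeff_formalNeg hg) hg
  rwa [formalAdd_formalNeg_self hg, sub_zero] at h1

theorem associated_formalAdd_formalNeg_left (hf : constantCoeff f = 0)
    (hg : constantCoeff g = 0) : Associated (f - g) (formalAdd (formalNeg f) g) := by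
  have h1 := associated_formalAdd_sub_left hg (constantCoeff_formalNeg hf) hf
  rw [formalAdd_formalNeg_self hf, sub_zero,
    formalAdd_comm hg (constantCoeff_formalNeg hf)] at h1
  refine Associated.trans ?_ h1
  rw [← neg_sub]
  exact (Associated.refl _).neg_left

theorem associated_formalNeg_sub (hf : constantCoeff f = 0) (hg : constantCoeff g = 0) :
    Associated (f - g) (formalNeg f - formalNeg g) := by
  have h1 := associated_formalAdd_sub_left (constantCoeff_formalNeg hf) hg
    (constantCoeff_formalNeg hg)
  rw [formalAdd_comm (constantCoeff_formalNeg hg) hg, formalAdd_formalNeg_self hg,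
    sub_zero] at h1
  exact (associated_formalAdd_formalNeg_left hf hg).trans h1.symm

end FormalGroupLaw

/-! ### The symmetric group action, alternating series and the Vandermonde determinant -/

variable {n : ℕ}

theorem permX_eq_rename (w : Equiv.Perm (Fin n)) (f : XBSeries n) :
    permX w f = rename (Equiv.sumCongr w (Equiv.refl ℕ)) f := rfl

theorem permX_eq_subst (w : Equiv.Perm (Fin n)) (f : XBSeries n) :
    permX w f = f.subst (X ∘ Equiv.sumCongr w (Equiv.refl ℕ)) := rename_eq_subst _ _

theorem permX_permX (w w' : Equiv.Perm (Fin n)) (f : XBSeries n) :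
    permX w (permX w' f) = permX (w * w') f := by
  rw [permX_eq_rename, permX_eq_rename, rename_rename, permX_eq_rename]
  congr 2
  ext t
  rcases t with t | t <;> rfl

theorem permX_xVar (w : Equiv.Perm (Fin n)) (i : Fin n) : permX w (xVar i) = xVar (w i) := by
  rw [permX_eq_rename, xVar, rename_X]; rfl

theorem permX_bIncl (w : Equiv.Perm (Fin n)) (c : BSeries) :
    permX w (bIncl n c) = bIncl n c := by
  rw [permX_eq_rename, bIncl, rename_rename]
  rfl

theorem order_le_order_permX (w : Equiv.Perm (Fin n)) (f : XBSeries n) :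
    f.order ≤ (permX w f).order := by
  rw [permX_eq_subst]
  exact order_le_order_subst (HasSubst.X_comp _) (fun i => constantCoeff_X _) f

theorem constantCoeff_xVar (i : Fin n) : constantCoeff (xVar i) = 0 := constantCoeff_X _

theorem constantCoeff_bVar (k : ℕ) : constantCoeff (bVar k : XBSeries n) = 0 := constantCoeff_X _

/-- The endomorphism `x_i ↦ x_j`. -/
abbrev mergeX (i j : Fin n) : XBSeries n →ₐ[LazardRing] XBSeries n :=
  specialize (Sum.inl i) (constantCoeff_xVar j)

theorem mergeX_permX_swap (i j : Fin n) (f : XBSeries n) :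
    mergeX i j (permX (Equiv.swap i j) f) = mergeX i j f := by
  rw [permX_eq_subst, specialize_subst _ _ (HasSubst.X_comp _), specialize_eq_subst]
  congr 1
  ext1 t
  classical
  rw [Function.comp_apply, specialize_X, specialize_X]
  rcases t with t | t
  · simp only [Equiv.sumCongr_apply, Sum.map_inl, Sum.inl.injEq, xVar]
    by_cases hi : t = i
    · subst hi; simp
    · by_cases hj : t = j
      · subst hj; simp
      · rw [Equiv.swap_apply_of_ne_of_ne hi hj]
  · simp only [Equiv.sumCongr_apply, Sum.map_inr, Equiv.refl_apply]

/-- The signed sum of the images of `f` under permutations of the `x_i`. -/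
def alternation (f : XBSeries n) : XBSeries n :=
  ∑ w : Equiv.Perm (Fin n), ((Equiv.Perm.sign w : ℤ) : XBSeries n) * permX w f

theorem sign_mul_sign (w : Equiv.Perm (Fin n)) :
    ((Equiv.Perm.sign w : ℤ) : XBSeries n) * ((Equiv.Perm.sign w : ℤ) : XBSeries n) = 1 := by
  rw [← Int.cast_mul, ← Units.val_mul, Int.units_mul_self]
  simp

theorem permX_alternation (w : Equiv.Perm (Fin n)) (f : XBSeries n) :
    permX w (alternation f) = ((Equiv.Perm.sign w : ℤ) : XBSeries n) * alternation f := by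
  rw [alternation, map_sum, Finset.mul_sum]
  refine Fintype.sum_equiv (Equiv.mulLeft w) _ _ fun w' => ?_
  rw [map_mul, map_intCast, permX_permX, Equiv.coe_mulLeft, ← mul_assoc,
    Equiv.Perm.sign_mul, Units.val_mul, Int.cast_mul, ← mul_assoc, sign_mul_sign, one_mul]

/-- The terms of `w` and `(i j) w` become equal with opposite signs once `x_i = x_j`. Cancelling in
pairs avoids dividing by `2`. -/
theorem mergeX_alternation {i j : Fin n} (hij : i ≠ j) (f : XBSeries n) :
    mergeX i j (alternation f) = 0 := by
  rw [alternation, map_sum]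
  refine Finset.sum_involution (fun w _ => Equiv.swap i j * w) ?_ ?_ ?_ ?_
  · intro w _
    rw [← permX_permX, map_mul, map_mul, mergeX_permX_swap, map_intCast, map_intCast,
      Equiv.Perm.sign_mul, Equiv.Perm.sign_swap hij]
    simp
  · intro w _ _ h
    apply hij
    have h1 : Equiv.swap i j = 1 := mul_eq_right.1 h
    exact Equiv.swap_eq_one_iff.1 h1
  · intro w _
    exact Finset.mem_univ _
  · intro w _
    rw [← mul_assoc, Equiv.swap_mul_self, one_mul]

/-- The Vandermonde determinant in `x_1, …, x_n`. -/
def vandermondeX (n : ℕ) : XBSeries n := (Matrix.vandermonde (xVar (n := n))).det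

/-- The pairs `i < j`. -/
def orderedPairs (n : ℕ) : Finset (Σ _ : Fin n, Fin n) :=
  Finset.univ.sigma fun i => Finset.Ioi i

theorem mem_orderedPairs {p : Σ _ : Fin n, Fin n} : p ∈ orderedPairs n ↔ p.1 < p.2 := by
  simp [orderedPairs]

theorem card_orderedPairs : (orderedPairs n).card = ∑ i : Fin n, (i.rev : ℕ) := by
  rw [orderedPairs, Finset.card_sigma]
  refine Finset.sum_congr rfl fun i _ => ?_
  rw [Fin.card_Ioi, Fin.val_rev]
  omega

theorem vandermondeX_eq_prod : vandermondeX n =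
    ∏ p ∈ orderedPairs n, (X (Sum.inl p.2) - X (Sum.inl p.1)) := by
  rw [vandermondeX, Matrix.det_vandermonde, orderedPairs, Finset.prod_sigma]
  rfl

theorem permX_vandermondeX (w : Equiv.Perm (Fin n)) :
    permX w (vandermondeX n) = ((Equiv.Perm.sign w : ℤ) : XBSeries n) * vandermondeX n := by
  rw [vandermondeX, AlgEquiv.map_det, ← Matrix.det_permute]
  congr 1
  ext1 i j
  simp [Matrix.vandermonde_apply, permX_xVar]

theorem vandermondeX_mem_nonZeroDivisors : vandermondeX n ∈ nonZeroDivisors (XBSeries n) := by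
  rw [vandermondeX_eq_prod]
  refine Submonoid.prod_mem _ fun p hp => X_sub_X_mem_nonZeroDivisors ?_
  simpa using (mem_orderedPairs.1 hp).ne'

theorem vandermondeX_dvd_alternation (f : XBSeries n) : vandermondeX n ∣ alternation f := by
  classical
  rw [vandermondeX_eq_prod]
  refine prod_dvd_of_ringHom _ _ (fun p => (mergeX p.2 p.1 : XBSeries n →+* XBSeries n))
    (fun p _ g hg => dvd_of_specialize_eq_zero _ (constantCoeff_xVar p.1) hg) ?_
    (fun p hp => mergeX_alternation (mem_orderedPairs.1 hp).ne' f)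
  rintro ⟨i, j⟩ hp ⟨k, l⟩ hq hpq
  rw [mem_orderedPairs] at hp hq
  simp only at hp hq
  rw [RingHom.coe_coe, map_sub, specialize_X, specialize_X, xVar]
  have hne : ¬(i = k ∧ j = l) := by
    rintro ⟨rfl, rfl⟩; exact hpq rfl
  simp only [Sum.inl.injEq]
  -- The map for the pair `i < j` sends `x_j` to `x_i`. The factor of another pair `k < l` would
  -- collapse only if `l = j` and `k = i`, or if `k = j` and `l = i`; the first is the same pair and
  -- the second contradicts the ordering.
  split_ifs with h1 h2 h2
  · omega
  · apply X_sub_X_mem_nonZeroDivisors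
    simp only [ne_eq, Sum.inl.injEq]
    intro h; apply hne; omega
  · apply X_sub_X_mem_nonZeroDivisors
    simp only [ne_eq, Sum.inl.injEq]
    omega
  · apply X_sub_X_mem_nonZeroDivisors
    simp only [ne_eq, Sum.inl.injEq]
    omega

/-! ### The sum of fractions is a symmetric power series -/

theorem exists_isUnit_schurDenom : ∃ u : (XBSeries n)ˣ, schurDenom n = vandermondeX n * u := by
  have : Associated (vandermondeX n) (schurDenom n) := by
    rw [vandermondeX, Matrix.det_vandermonde, schurDenom]
    refine Associated.prod _ _ _ fun i _ => Associated.prod _ _ _ fun j _ => ?_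
    rw [← neg_sub]
    exact (associated_formalAdd_formalNeg (constantCoeff_xVar i) (constantCoeff_xVar j)).neg_left
  obtain ⟨u, hu⟩ := this
  exact ⟨u, hu.symm⟩

/-- The unit `schurDenom n / vandermondeX n`. -/
def denomUnit (n : ℕ) : (XBSeries n)ˣ := Classical.choose exists_isUnit_schurDenom

theorem schurDenom_eq : schurDenom n = vandermondeX n * denomUnit n :=
  Classical.choose_spec exists_isUnit_schurDenom

/-- The numerator of the universal factorial Schur function over the Vandermonde determinant. -/
def schurAlternant (lam : Partitions n) : XBSeries n :=
  alternation (schurNum lam * ↑(denomUnit n)⁻¹)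

/-- A permutation changes the Vandermonde determinant only by its sign, so it serves as a common
denominator; the inverse of the remaining unit is moved into the numerator. -/
theorem algebraMap_vandermondeX_mul_schurFraction (lam : Partitions n) :
    algebraMap (XBSeries n) (FractionRing (XBSeries n)) (vandermondeX n) * schurFraction lam =
      algebraMap (XBSeries n) (FractionRing (XBSeries n)) (schurAlternant lam) := by
  rw [schurFraction, Finset.mul_sum, schurAlternant, alternation, map_sum]
  refine Finset.sum_congr rfl fun w _ => ?_
  have hD : schurDenom n ∈ nonZeroDivisors (XBSeries n) := by
    rw [schurDenom_eq]
    exact mul_mem vandermondeX_mem_nonZeroDivisors (denomUnit n).isUnit.mem_nonZeroDivisors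
  have hwD : permX w (schurDenom n) ∈ nonZeroDivisors (XBSeries n) :=
    (MulEquivClass.map_nonZeroDivisors (permX w)).le ⟨_, hD, rfl⟩
  have hunit : IsUnit (algebraMap (XBSeries n) (FractionRing (XBSeries n))
      (permX w (schurDenom n))) := IsLocalization.map_units _ (⟨_, hwD⟩ : nonZeroDivisors _)
  rw [← hunit.mul_left_inj, mul_assoc, mul_assoc, Ring.inverse_mul_cancel _ hunit, mul_one,
    ← map_mul, ← map_mul]
  congr 1
  rw [schurDenom_eq, map_mul, map_mul, permX_vandermondeX]
  have h1 : permX w (↑(denomUnit n)⁻¹ : XBSeries n) * permX w (denomUnit n : XBSeries n) = 1 := by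
    rw [← map_mul, Units.inv_mul, map_one]
  linear_combination (-vandermondeX n * permX w (schurNum lam)) *
      ((Equiv.Perm.sign w : ℤ) : XBSeries n) * ((Equiv.Perm.sign w : ℤ) : XBSeries n) * h1 -
      vandermondeX n * permX w (schurNum lam) * sign_mul_sign w

theorem algebraMap_universalFactorialSchur (lam : Partitions n) :
    algebraMap (XBSeries n) (FractionRing (XBSeries n)) (universalFactorialSchur lam) =
      schurFraction lam := by
  suffices h : ∃ s : XBSeries n,
      algebraMap (XBSeries n) (FractionRing (XBSeries n)) s = schurFraction lam from
    Classical.epsilon_spec h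
  obtain ⟨s, hs⟩ := vandermondeX_dvd_alternation (schurNum lam * (↑(denomUnit n)⁻¹ : XBSeries n))
  refine ⟨s, ?_⟩
  have hunit : IsUnit (algebraMap (XBSeries n) (FractionRing (XBSeries n)) (vandermondeX n)) :=
    IsLocalization.map_units _
      (⟨_, vandermondeX_mem_nonZeroDivisors⟩ : nonZeroDivisors (XBSeries n))
  rw [← hunit.mul_right_inj, algebraMap_vandermondeX_mul_schurFraction, ← map_mul, ← hs]
  rfl

theorem vandermondeX_mul_universalFactorialSchur (lam : Partitions n) :
    vandermondeX n * universalFactorialSchur lam = schurAlternant lam := by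
  apply IsFractionRing.injective (XBSeries n) (FractionRing (XBSeries n))
  rw [map_mul, algebraMap_universalFactorialSchur, algebraMap_vandermondeX_mul_schurFraction]

theorem universalFactorialSchur_mem (lam : Partitions n) :
    universalFactorialSchur lam ∈ symmetricSeries n := by
  intro w
  rw [← mul_cancel_left_mem_nonZeroDivisors (vandermondeX_mem_nonZeroDivisors (n := n)),
    vandermondeX_mul_universalFactorialSchur]
  have h := congrArg (permX w) (vandermondeX_mul_universalFactorialSchur lam)
  rw [map_mul, permX_vandermondeX, schurAlternant, permX_alternation, ← schurAlternant] at h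
  linear_combination ((Equiv.Perm.sign w : ℤ) : XBSeries n) * h + (schurAlternant lam -
    vandermondeX n * permX w (universalFactorialSchur lam)) * sign_mul_sign w

/-! ### Order estimates -/

/-- The size of a partition. -/
def size (lam : Partitions n) : ℕ := ∑ i, lam.1 i

theorem le_order_sum {ι σ R : Type*} [CommRing R] (S : Finset ι) (f : ι → MvPowerSeries σ R)
    (N : ℕ∞) (h : ∀ i ∈ S, N ≤ (f i).order) : N ≤ (∑ i ∈ S, f i).order := by
  apply le_order
  intro d hd
  rw [map_sum]
  exact Finset.sum_eq_zero fun i hi => coeff_of_lt_order (hd.trans_le (h i hi))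

theorem le_order_mul_left {σ R : Type*} [CommRing R] (f g : MvPowerSeries σ R) :
    g.order ≤ (f * g).order := le_trans le_add_self le_order_mul

theorem le_order_factorialPow {t : XBSeries n} (ht : constantCoeff t = 0) (k : ℕ) :
    (k : ℕ∞) ≤ (factorialPow t k).order := by
  refine le_trans ?_ (le_order_prod _ _)
  calc (k : ℕ∞) = ∑ j ∈ Finset.range k, 1 := by simp
    _ ≤ _ := Finset.sum_le_sum fun j _ => one_le_order_iff_constCoeff_eq_zero.2
      (constantCoeff_formalAdd ht (constantCoeff_bVar j))

/-- Each term of the alternant has order at least `|λ| + n(n-1)/2`, and division by the Vandermonde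
determinant costs one for each of its `n(n-1)/2` factors. This bound makes infinite combinations
converge. -/
theorem size_le_order_universalFactorialSchur (lam : Partitions n) :
    (size lam : ℕ∞) ≤ (universalFactorialSchur lam).order := by
  refine le_order_of_prod_mul (orderedPairs n) (fun p => Sum.inl p.2) (fun p => Sum.inl p.1)
    (fun p hp => by simpa using (mem_orderedPairs.1 hp).ne') _ _ ?_
  rw [← vandermondeX_eq_prod, vandermondeX_mul_universalFactorialSchur, card_orderedPairs, size,
    ← Finset.sum_add_distrib]
  refine le_order_sum _ _ _ fun w _ => ?_
  refine le_trans ?_ (le_order_mul_left _ _)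
  refine le_trans ?_ (order_le_order_permX _ _)
  rw [mul_comm]
  refine le_trans ?_ (le_order_mul_left _ _)
  refine le_trans ?_ (le_order_prod _ _)
  rw [Nat.cast_sum]
  exact Finset.sum_le_sum fun i _ => le_order_factorialPow (constantCoeff_xVar i) _

/-! ### Evaluation at formal inverses of the `b`-variables -/

/-- The point `x_i ↦` formal inverse of `b_{k i}`, `b_m ↦ b_m`. -/
def evalPoint (k : Fin n → ℕ) : Fin n ⊕ ℕ → BSeries :=
  Sum.elim (fun i => formalNeg (X (k i))) X

theorem constantCoeff_evalPoint (k : Fin n → ℕ) (t : Fin n ⊕ ℕ) :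
    constantCoeff (evalPoint k t) = 0 := by
  rcases t with i | j
  · exact constantCoeff_formalNeg_X _
  · exact constantCoeff_X _

theorem hasSubst_evalPoint (k : Fin n → ℕ) : HasSubst (evalPoint k) := by
  refine ⟨fun t => by rw [constantCoeff_evalPoint]; exact IsNilpotent.zero, fun d => ?_⟩
  have h := (HasSubst.X (σ := ℕ) (S := LazardRing)).coeff_zero d
  refine ((Set.finite_range (Sum.inl : Fin n → Fin n ⊕ ℕ)).union
    (h.image (Sum.inr : ℕ → Fin n ⊕ ℕ))).subset ?_
  rintro (i | j) hj
  · exact Or.inl ⟨i, rfl⟩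
  · exact Or.inr ⟨j, hj, rfl⟩

/-- Evaluation at `x_i = ` formal inverse of `b_{k i}`. -/
def evalAt (k : Fin n → ℕ) : XBSeries n →ₐ[LazardRing] BSeries :=
  substAlgHom (hasSubst_evalPoint k)

theorem evalAt_apply (k : Fin n → ℕ) (f : XBSeries n) : evalAt k f = f.subst (evalPoint k) := by
  rw [evalAt, coe_substAlgHom]

theorem order_le_order_evalAt (k : Fin n → ℕ) (f : XBSeries n) :
    f.order ≤ (evalAt k f).order := by
  rw [evalAt_apply]
  exact order_le_order_subst (hasSubst_evalPoint k) (constantCoeff_evalPoint k) f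

theorem evalAt_xVar (k : Fin n → ℕ) (i : Fin n) :
    evalAt k (xVar i) = formalNeg (X (k i)) := by
  rw [evalAt_apply, xVar, subst_X (hasSubst_evalPoint k)]; rfl

theorem evalAt_bVar (k : Fin n → ℕ) (j : ℕ) : evalAt k (bVar j) = X j := by
  rw [evalAt_apply, bVar, subst_X (hasSubst_evalPoint k)]; rfl

theorem evalAt_bIncl (k : Fin n → ℕ) (c : BSeries) : evalAt k (bIncl n c) = c := by
  rw [evalAt_apply, bIncl, rename_eq_subst,
    subst_comp_subst_apply (HasSubst.X_comp _) (hasSubst_evalPoint k)]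
  have : (fun s => subst (evalPoint k)
      ((X ∘ (Function.Embedding.inr : ℕ ↪ Fin n ⊕ ℕ)) s : XBSeries n)) = X := by
    ext1 s
    rw [Function.comp_apply, subst_X (hasSubst_evalPoint k)]
    rfl
  rw [this, subst_self, id]

theorem evalAt_permX (k : Fin n → ℕ) (w : Equiv.Perm (Fin n)) (f : XBSeries n) :
    evalAt k (permX w f) = evalAt (k ∘ w) f := by
  have h : (fun t => subst (evalPoint k)
      ((X ∘ Equiv.sumCongr w (Equiv.refl ℕ)) t : XBSeries n)) = evalPoint (k ∘ w) := by
    ext1 t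
    rw [Function.comp_apply, subst_X (hasSubst_evalPoint k)]
    rcases t with t | t <;> simp only [Equiv.sumCongr_apply, Sum.map_inl, Sum.map_inr,
      evalPoint, Sum.elim_inl, Sum.elim_inr, Function.comp_apply, Equiv.refl_apply]
  rw [evalAt_apply, permX_eq_subst,
    subst_comp_subst_apply (HasSubst.X_comp _) (hasSubst_evalPoint k), evalAt_apply, h]

theorem evalAt_comp_of_mem (k : Fin n → ℕ) (w : Equiv.Perm (Fin n)) {f : XBSeries n}
    (hf : f ∈ symmetricSeries n) : evalAt (k ∘ w) f = evalAt k f := by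
  rw [← evalAt_permX, hf w]

theorem evalAt_factorialPow (k : Fin n → ℕ) (i : Fin n) (l : ℕ) :
    evalAt k (factorialPow (xVar i) l) =
      ∏ j ∈ Finset.range l, formalAdd (formalNeg (X (k i))) (X j) := by
  rw [factorialPow, map_prod]
  refine Finset.prod_congr rfl fun j _ => ?_
  rw [evalAt_apply, subst_formalAdd (hasSubst_evalPoint k) (constantCoeff_xVar i)
    (constantCoeff_bVar j), ← evalAt_apply, ← evalAt_apply, evalAt_xVar, evalAt_bVar]

theorem evalAt_factorialPow_eq_zero (k : Fin n → ℕ) (i : Fin n) {l : ℕ} (h : k i < l) :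
    evalAt k (factorialPow (xVar i) l) = 0 := by
  rw [evalAt_factorialPow]
  refine Finset.prod_eq_zero (Finset.mem_range.2 h) ?_
  rw [formalAdd_comm (constantCoeff_formalNeg (constantCoeff_X _)) (constantCoeff_X _),
    formalAdd_formalNeg_self (constantCoeff_X _)]

/-! ### Vanishing and diagonal values -/

/-- The sequence `μ_i + n - i`, with values in the index set of the `b_k`. -/
def betaSeq (mu : Partitions n) (i : Fin n) : ℕ := mu.1 i + (i.rev : ℕ)

theorem localization_apply (f : XBSeries n) (mu : Partitions n) :
    localization n f mu = evalAt (betaSeq mu) f := rfl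

theorem betaSeq_strictAnti (mu : Partitions n) : StrictAnti (betaSeq mu) := by
  intro i j hij
  have h1 := mu.2 hij.le
  have h2 : (j.rev : ℕ) < i.rev := by rw [Fin.val_rev, Fin.val_rev]; omega
  exact add_lt_add_of_le_of_lt h1 h2

theorem betaSeq_le_betaSeq_iff (lam mu : Partitions n) (i : Fin n) :
    betaSeq lam i ≤ betaSeq mu i ↔ lam.1 i ≤ mu.1 i := by
  rw [betaSeq, betaSeq, add_le_add_iff_right]

theorem sum_betaSeq (lam : Partitions n) :
    ∑ i, betaSeq lam i = size lam + ∑ i : Fin n, (i.rev : ℕ) := Finset.sum_add_distrib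

/-- Pigeonhole: if `m i < l i`, then `w` would map the `k ≤ i` injectively into the indices `< i`.
-/
theorem le_of_le_comp_perm {l m : Fin n → ℕ} (hl : StrictAnti l) (hm : StrictAnti m)
    (w : Equiv.Perm (Fin n)) (h : ∀ i, l i ≤ m (w i)) (i : Fin n) : l i ≤ m i := by
  by_contra! hi
  have h1 : (Finset.Iic i).card ≤ (Finset.Iio i).card := by
    refine Finset.card_le_card_of_injOn w ?_ w.injective.injOn
    intro k hk
    rw [Finset.mem_coe, Finset.mem_Iic] at hk
    rw [Finset.mem_coe, Finset.mem_Iio]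
    have := hi.trans_le ((hl.antitone hk).trans (h k))
    exact hm.lt_iff_gt.1 this
  rw [Fin.card_Iic, Fin.card_Iio] at h1
  omega

theorem perm_eq_one_of_le_comp {l : Fin n → ℕ} (hl : StrictAnti l) (w : Equiv.Perm (Fin n))
    (h : ∀ i, l i ≤ l (w i)) : w = 1 := by
  have h1 := (Finset.sum_eq_sum_iff_of_le (s := Finset.univ) fun i _ => h i).1
    (Equiv.sum_comp w l).symm
  ext1 i
  exact (hl.injective (h1 i (Finset.mem_univ i))).symm

theorem evalAt_schurNum_comp_eq_zero {lam : Partitions n} {k : Fin n → ℕ}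
    (h : ∃ i, k i < betaSeq lam i) : evalAt k (schurNum lam) = 0 := by
  obtain ⟨i, hi⟩ := h
  rw [schurNum, map_prod]
  exact Finset.prod_eq_zero (Finset.mem_univ i) (evalAt_factorialPow_eq_zero k i hi)

theorem evalAt_schurAlternant (lam : Partitions n) (k : Fin n → ℕ) :
    evalAt k (schurAlternant lam) = ∑ w : Equiv.Perm (Fin n),
      ((Equiv.Perm.sign w : ℤ) : BSeries) * (evalAt (k ∘ w) (schurNum lam) *
        evalAt (k ∘ w) (↑(denomUnit n)⁻¹ : XBSeries n)) := by
  rw [schurAlternant, alternation, map_sum]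
  refine Finset.sum_congr rfl fun w _ => ?_
  rw [map_mul, map_intCast, evalAt_permX, map_mul]

theorem associated_evalAt_vandermondeX (k : Fin n → ℕ) :
    Associated (∏ p ∈ orderedPairs n, (X (k p.1) - X (k p.2) : BSeries))
      (evalAt k (vandermondeX n)) := by
  rw [vandermondeX_eq_prod, map_prod]
  refine Associated.prod _ _ _ fun p _ => ?_
  change Associated _ (evalAt k (xVar p.2 - xVar p.1))
  rw [map_sub, evalAt_xVar, evalAt_xVar, ← neg_sub]
  exact (associated_formalNeg_sub (constantCoeff_X _) (constantCoeff_X _)).neg_left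

theorem mem_nonZeroDivisors_of_associated {A : Type*} [CommRing A] {a b : A}
    (h : Associated a b) (ha : a ∈ nonZeroDivisors A) : b ∈ nonZeroDivisors A := by
  obtain ⟨u, rfl⟩ := h
  exact mul_mem ha u.isUnit.mem_nonZeroDivisors

theorem evalAt_vandermondeX_mem_nonZeroDivisors {k : Fin n → ℕ} (hk : Function.Injective k) :
    evalAt k (vandermondeX n) ∈ nonZeroDivisors BSeries := by
  refine mem_nonZeroDivisors_of_associated (associated_evalAt_vandermondeX k) ?_
  exact Submonoid.prod_mem _ fun p hp =>
    X_sub_X_mem_nonZeroDivisors (hk.ne (mem_orderedPairs.1 hp).ne)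

/-- The vanishing property of the universal factorial Schur functions. -/
theorem evalAt_universalFactorialSchur_eq_zero {lam mu : Partitions n}
    (h : ¬ ∀ i, lam.1 i ≤ mu.1 i) : evalAt (betaSeq mu) (universalFactorialSchur lam) = 0 := by
  have h1 := congrArg (evalAt (betaSeq mu)) (vandermondeX_mul_universalFactorialSchur lam)
  rw [map_mul] at h1
  rw [← mul_left_mem_nonZeroDivisors_eq_zero_iff
    (evalAt_vandermondeX_mem_nonZeroDivisors (betaSeq_strictAnti mu).injective), h1,
    evalAt_schurAlternant]
  -- A nonzero summand requires `betaSeq lam i ≤ betaSeq mu (w i)` for all `i`, since otherwise a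
  -- numerator factor is a formal difference of equal variables.
  refine Finset.sum_eq_zero fun w _ => ?_
  rw [evalAt_schurNum_comp_eq_zero, zero_mul, mul_zero]
  by_contra! h2
  apply h
  intro i
  rw [← betaSeq_le_betaSeq_iff]
  exact le_of_le_comp_perm (betaSeq_strictAnti lam) (betaSeq_strictAnti mu) w h2 i

theorem evalAt_universalFactorialSchur_eq_zero_of_size {lam mu : Partitions n}
    (h : size mu ≤ size lam) (hne : mu ≠ lam) :
    evalAt (betaSeq mu) (universalFactorialSchur lam) = 0 := by
  apply evalAt_universalFactorialSchur_eq_zero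
  intro hle
  apply hne
  have h1 := (Finset.sum_eq_sum_iff_of_le (s := Finset.univ) fun i _ => hle i).1
    (le_antisymm (Finset.sum_le_sum fun i _ => hle i) h)
  ext i
  exact (h1 i (Finset.mem_univ i)).symm

/-- The index pairs `(i, j)` with `j < λ_i + n - i` such that `j` is not in the set of `λ`. -/
def inversions (lam : Partitions n) : Finset (Σ _ : Fin n, ℕ) :=
  Finset.univ.sigma fun i =>
    (Finset.range (betaSeq lam i)).filter (· ∉ Finset.univ.image (betaSeq lam))

theorem mem_inversions {lam : Partitions n} {p : Σ _ : Fin n, ℕ} :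
    p ∈ inversions lam ↔ p.2 < betaSeq lam p.1 ∧ ∀ i, betaSeq lam i ≠ p.2 := by
  simp [inversions]

/-- The product of `b_{λ_i + n - i} - b_j` over all inversions. -/
def inversionProd (lam : Partitions n) : BSeries :=
  ∏ p ∈ inversions lam, (X (betaSeq lam p.1) - X p.2)

theorem inversionProd_mem_nonZeroDivisors (lam : Partitions n) :
    inversionProd lam ∈ nonZeroDivisors BSeries :=
  Submonoid.prod_mem _ fun _ hp =>
    X_sub_X_mem_nonZeroDivisors ((mem_inversions.1 hp).2 _)

/-- The indices `j` below `betaSeq lam i` that lie in the set of `λ` are the `betaSeq lam k` with `k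
> i`. They give the Vandermonde factors, and the others give the inversions. -/
theorem prod_range_betaSeq (lam : Partitions n) :
    ∏ i, ∏ j ∈ Finset.range (betaSeq lam i), (X (betaSeq lam i) - X j : BSeries) =
      inversionProd lam *
        ∏ p ∈ orderedPairs n, (X (betaSeq lam p.1) - X (betaSeq lam p.2)) := by
  rw [inversionProd, inversions, Finset.prod_sigma, orderedPairs, Finset.prod_sigma,
    ← Finset.prod_mul_distrib]
  refine Finset.prod_congr rfl fun i _ => ?_
  rw [← Finset.prod_filter_mul_prod_filter_not (Finset.range (betaSeq lam i))
    (· ∉ Finset.univ.image (betaSeq lam))]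
  congr 1
  have h : (Finset.range (betaSeq lam i)).filter (¬ · ∉ Finset.univ.image (betaSeq lam)) =
      (Finset.Ioi i).image (betaSeq lam) := by
    ext j
    simp only [Finset.mem_filter, Finset.mem_range, Finset.mem_image, Finset.mem_univ, true_and,
      not_not, Finset.mem_Ioi]
    constructor
    · rintro ⟨h1, k, rfl⟩
      exact ⟨k, (betaSeq_strictAnti lam).lt_iff_gt.1 h1, rfl⟩
    · rintro ⟨k, hk, rfl⟩
      exact ⟨betaSeq_strictAnti lam hk, k, rfl⟩
  rw [h, Finset.prod_image (betaSeq_strictAnti lam).injective.injOn]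

/-- The value of the universal factorial Schur function of `λ` at `λ`. -/
theorem associated_evalAt_self (lam : Partitions n) :
    Associated (inversionProd lam) (evalAt (betaSeq lam) (universalFactorialSchur lam)) := by
  have h1 := congrArg (evalAt (betaSeq lam)) (vandermondeX_mul_universalFactorialSchur lam)
  -- Only the identity survives: `betaSeq lam ≤ betaSeq lam ∘ w` pointwise forces equality, because
  -- both sides have the same sum.
  rw [map_mul, evalAt_schurAlternant, Finset.sum_eq_single 1] at h1
  rotate_left
  · intro w _ hw
    rw [evalAt_schurNum_comp_eq_zero, zero_mul, mul_zero]
    by_contra! h2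
    exact hw (perm_eq_one_of_le_comp (betaSeq_strictAnti lam) w h2)
  · intro h; exact absurd (Finset.mem_univ _) h
  rw [Equiv.Perm.sign_one, Equiv.Perm.coe_one, Function.comp_id, Units.val_one, Int.cast_one,
    one_mul] at h1
  obtain ⟨u, hu⟩ := associated_evalAt_vandermondeX (betaSeq lam)
  have h2 : Associated (∏ i, ∏ j ∈ Finset.range (betaSeq lam i), (X (betaSeq lam i) - X j))
      (evalAt (betaSeq lam) (schurNum lam)) := by
    rw [schurNum, map_prod]
    refine Associated.prod _ _ _ fun i _ => ?_
    change Associated _ (evalAt (betaSeq lam) (factorialPow (xVar i) (betaSeq lam i)))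
    rw [evalAt_factorialPow]
    exact Associated.prod _ _ _ fun j _ =>
      associated_formalAdd_formalNeg_left (constantCoeff_X _) (constantCoeff_X _)
  rw [prod_range_betaSeq] at h2
  obtain ⟨v, hv⟩ := h2
  have hz : IsUnit (evalAt (betaSeq lam) (↑(denomUnit n)⁻¹ : XBSeries n)) :=
    (denomUnit n)⁻¹.isUnit.map (evalAt (betaSeq lam))
  obtain ⟨z, hz⟩ := hz
  rw [← hz, ← hv, ← hu] at h1
  have hreg : (∏ p ∈ orderedPairs n, (X (betaSeq lam p.1) - X (betaSeq lam p.2) : BSeries)) ∈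
      nonZeroDivisors BSeries := Submonoid.prod_mem _ fun p hp =>
    X_sub_X_mem_nonZeroDivisors ((betaSeq_strictAnti lam).injective.ne (mem_orderedPairs.1 hp).ne)
  refine ⟨v * z * u⁻¹, ?_⟩
  rw [← mul_cancel_left_mem_nonZeroDivisors hreg, Units.val_mul, Units.val_mul]
  have hu1 : (u : BSeries) * (↑u⁻¹ : BSeries) = 1 := Units.mul_inv u
  linear_combination (-(↑u⁻¹ : BSeries)) * h1 +
    (∏ p ∈ orderedPairs n, (X (betaSeq lam p.1) - X (betaSeq lam p.2) : BSeries)) *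
      evalAt (betaSeq lam) (universalFactorialSchur lam) * hu1

theorem evalAt_self_mem_nonZeroDivisors (lam : Partitions n) :
    evalAt (betaSeq lam) (universalFactorialSchur lam) ∈ nonZeroDivisors BSeries :=
  mem_nonZeroDivisors_of_associated (associated_evalAt_self lam)
    (inversionProd_mem_nonZeroDivisors lam)

theorem exists_perm_of_range_eq {k l : Fin n → ℕ} (hk : Function.Injective k)
    (hl : Function.Injective l) (h : Set.range l = Set.range k) :
    ∃ w : Equiv.Perm (Fin n), l = k ∘ w := by
  refine ⟨((Equiv.ofInjective l hl).trans (Equiv.setCongr h)).trans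
    (Equiv.ofInjective k hk).symm, ?_⟩
  ext1 i
  simp [Equiv.apply_ofInjective_symm]

/-- Every `n`-element set of indices belongs to a partition. -/
theorem exists_partition {k : Fin n → ℕ} (hk : Function.Injective k) :
    ∃ (mu : Partitions n) (w : Equiv.Perm (Fin n)), betaSeq mu = k ∘ w := by
  classical
  have hcard : (Finset.univ.image k).card = n := by
    rw [Finset.card_image_of_injective _ hk, Finset.card_univ, Fintype.card_fin]
  let e := (Finset.univ.image k).orderEmbOfFin hcard
  -- The increasing enumeration `e` grows by at least one per step, so `e i - i` is weakly
  -- increasing and no subtraction is truncated; read backwards, it is the partition.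
  have he (a : ℕ) : ∀ (b : ℕ) (ha : a < n) (hb : b < n), a ≤ b →
      e ⟨a, ha⟩ + (b - a) ≤ e ⟨b, hb⟩ := by
    intro b ha hb hab
    obtain ⟨d, rfl⟩ := Nat.exists_eq_add_of_le hab
    induction d with
    | zero => simp
    | succ d ih =>
      have h1 := ih (by omega) (by omega)
      have h2 : e ⟨a + d, by omega⟩ < e ⟨a + (d + 1), hb⟩ := e.strictMono (by
        rw [Fin.mk_lt_mk]; omega)
      omega
  have hle (i : Fin n) : (i : ℕ) ≤ e i := by
    have := he 0 i i.pos i.2 (Nat.zero_le _)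
    simp only [Fin.eta] at this
    omega
  let mu : Partitions n := ⟨fun i => e i.rev - (i.rev : ℕ), by
    intro i j hij
    have h1 : (j.rev : ℕ) ≤ i.rev := by rw [Fin.val_rev, Fin.val_rev]; omega
    have h2 := he j.rev i.rev j.rev.2 i.rev.2 h1
    simp only [Fin.eta] at h2
    change e j.rev - (j.rev : ℕ) ≤ e i.rev - (i.rev : ℕ)
    have := hle j.rev
    omega⟩
  have hmu (i : Fin n) : betaSeq mu i = e i.rev := Nat.sub_add_cancel (hle i.rev)
  have hrange : Set.range (betaSeq mu) = Set.range k := by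
    have h1 : Set.range e = Set.range k := by
      rw [Finset.range_orderEmbOfFin, Finset.coe_image, Finset.coe_univ, Set.image_univ]
    rw [← h1]
    have h2 : betaSeq mu = e ∘ Fin.rev := funext hmu
    rw [h2, Fin.rev_surjective.range_comp]
  obtain ⟨w, hw⟩ := exists_perm_of_range_eq hk (betaSeq_strictAnti mu).injective hrange
  exact ⟨mu, w, hw⟩

/-! ### The GKM congruences -/

/-- The endomorphism `b_i ↦ b_j` of `𝕃[[b]]`. -/
abbrev mergeB (i j : ℕ) : BSeries →ₐ[LazardRing] BSeries :=
  specialize i (constantCoeff_X j)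

theorem specialize_formalNeg {σ : Type*} (s : σ) {a f : MvPowerSeries σ LazardRing}
    (ha : constantCoeff a = 0) (hf : constantCoeff f = 0) :
    specialize s ha (formalNeg f) = formalNeg (specialize s ha f) := by
  classical
  rw [specialize_apply, specialize_apply, subst_formalNeg (hasSubst_update s ha) hf]

theorem dvd_of_mergeB_eq_zero {i j : ℕ} {f : BSeries} (h : mergeB i j f = 0) : X i - X j ∣ f :=
  dvd_of_specialize_eq_zero i (constantCoeff_X j) h

theorem mergeB_evalAt_swap (i j : ℕ) (k : Fin n → ℕ) (f : XBSeries n) :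
    mergeB i j (evalAt (Equiv.swap i j ∘ k) f) = mergeB i j (evalAt k f) := by
  rw [evalAt_apply, evalAt_apply, specialize_subst _ _ (hasSubst_evalPoint _),
    specialize_subst _ _ (hasSubst_evalPoint _)]
  refine congrArg (fun a => subst a f) (funext fun t => ?_)
  rcases t with t | t
  · simp only [evalPoint, Sum.elim_inl, Function.comp_apply]
    rw [specialize_formalNeg _ _ (constantCoeff_X _), specialize_formalNeg _ _ (constantCoeff_X _),
      specialize_X, specialize_X]
    congr 1
    by_cases hi : k t = i
    · rw [hi]; simp
    · by_cases hj : k t = j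
      · rw [hj]; simp
      · rw [Equiv.swap_apply_of_ne_of_ne hi hj]
  · simp only [evalPoint, Sum.elim_inr]

theorem associated_root (i j : ℕ) :
    Associated (X i - X j : BSeries) (formalAdd (X i) (formalNeg (X j))) :=
  associated_formalAdd_formalNeg (constantCoeff_X i) (constantCoeff_X j)

/-- By symmetry of `f` only the set of indices matters, and two sets exchanged by `(i j)` give the
same value once `b_i = b_j`. -/
theorem localization_mem_gkmRing {f : XBSeries n} (hf : f ∈ symmetricSeries n) :
    localization n f ∈ gkmRing n := by
  intro i j _ mu nu h
  rw [← (associated_root i j).dvd_iff_dvd_left]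
  have hk : Function.Injective (Equiv.swap i j ∘ betaSeq mu) :=
    (Equiv.injective _).comp (betaSeq_strictAnti mu).injective
  have hrange : Set.range (betaSeq nu) = Set.range (Equiv.swap i j ∘ betaSeq mu) := by
    rw [Set.range_comp]; exact h
  obtain ⟨w, hw⟩ := exists_perm_of_range_eq hk (betaSeq_strictAnti nu).injective hrange
  apply dvd_of_specialize_eq_zero i (constantCoeff_X j)
  rw [localization_apply, localization_apply, hw, evalAt_comp_of_mem _ _ hf, map_sub,
    mergeB_evalAt_swap, sub_self]

/-- The reflection replaces one element of the index set by the smaller missing `j`, which lowers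
the sum of the set and hence the size. -/
theorem exists_smaller_partition {lam : Partitions n} {i : Fin n} {j : ℕ}
    (h : j < betaSeq lam i) (hj : ∀ t, betaSeq lam t ≠ j) :
    ∃ nu : Partitions n, size nu < size lam ∧
      betaSet nu = Equiv.swap j (betaSeq lam i) '' betaSet lam := by
  obtain ⟨nu, w, hw⟩ := exists_partition (k := Equiv.swap j (betaSeq lam i) ∘ betaSeq lam)
    ((Equiv.injective _).comp (betaSeq_strictAnti lam).injective)
  refine ⟨nu, ?_, ?_⟩
  · have h1 : ∑ t, betaSeq nu t < ∑ t, betaSeq lam t := by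
      rw [hw]
      simp only [Function.comp_apply]
      rw [Equiv.sum_comp w fun t => Equiv.swap j (betaSeq lam i) (betaSeq lam t)]
      refine Finset.sum_lt_sum (fun t _ => ?_) ⟨i, Finset.mem_univ i, by simpa using h⟩
      by_cases ht : betaSeq lam t = betaSeq lam i
      · rw [ht, Equiv.swap_apply_right]; exact h.le
      · rw [Equiv.swap_apply_of_ne_of_ne (hj t) ht]
    rw [sum_betaSeq, sum_betaSeq] at h1
    omega
  · change Set.range (betaSeq nu) = _ '' Set.range (betaSeq lam)
    rw [hw, w.surjective.range_comp, Set.range_comp]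

/-- A family in the GKM ring that vanishes at all smaller partitions is divisible at `λ` by the
value of the universal factorial Schur function of `λ`. -/
theorem evalAt_self_dvd {psi : Partitions n → BSeries} (hpsi : psi ∈ gkmRing n)
    {lam : Partitions n} (h : ∀ nu, size nu < size lam → psi nu = 0) :
    evalAt (betaSeq lam) (universalFactorialSchur lam) ∣ psi lam := by
  rw [← (associated_evalAt_self lam).dvd_iff_dvd_left, inversionProd]
  refine prod_dvd_of_ringHom _ _
    (fun p => (mergeB (betaSeq lam p.1) p.2 : BSeries →+* BSeries))
    (fun p _ g hg => ?_) ?_ ?_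
  · rw [RingHom.coe_coe] at hg
    exact dvd_of_mergeB_eq_zero hg
  · rintro ⟨i, j⟩ hp ⟨k, l⟩ hq hpq
    rw [mem_inversions] at hp hq
    simp only at hp hq
    simp only [RingHom.coe_coe]
    -- The variable `b_l` is not moved, as `l` is outside the set of `λ`. The factor becomes `b_j -
    -- b_l` with `j ≠ l` if `k = i`, and is unchanged otherwise.
    rw [map_sub, specialize_X, specialize_X, if_neg (Ne.symm (hq.2 i))]
    split_ifs with h1
    · have hki := (betaSeq_strictAnti lam).injective h1
      subst hki
      apply X_sub_X_mem_nonZeroDivisors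
      rintro rfl
      exact hpq rfl
    · exact X_sub_X_mem_nonZeroDivisors (hq.2 k)
  · rintro ⟨i, j⟩ hp
    rw [mem_inversions] at hp
    -- Since `psi` vanishes at the reflected partition, the congruence makes the root divide `psi
    -- lam` itself.
    obtain ⟨nu, hsize, hnu⟩ := exists_smaller_partition hp.1 hp.2
    have hd := hpsi _ _ hp.1 lam nu hnu
    rw [h nu hsize, zero_sub, dvd_neg, ← (associated_root _ _).dvd_iff_dvd_left] at hd
    obtain ⟨q, hq⟩ := hd
    rw [hq, RingHom.coe_coe, map_mul, map_sub, specialize_X_self,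
      specialize_X_of_ne _ (Ne.symm (hp.2 i)), sub_self, zero_mul]

/-! ### Elimination by increasing size -/

theorem finite_size_lt (n N : ℕ) : {lam : Partitions n | size lam < N}.Finite := by
  refine Set.Finite.subset ((Set.finite_Iic (fun _ : Fin n => N)).preimage
    (Subtype.val_injective.injOn)) fun lam hlam i => ?_
  have h1 : lam.1 i ≤ size lam := Finset.single_le_sum (f := lam.1) (fun _ _ => Nat.zero_le _)
    (Finset.mem_univ i)
  exact h1.trans (le_of_lt hlam)

/-- The partitions of size less than `N`. -/
def sizeLT (n N : ℕ) : Finset (Partitions n) := (finite_size_lt n N).toFinset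

theorem mem_sizeLT {N : ℕ} {lam : Partitions n} : lam ∈ sizeLT n N ↔ size lam < N := by
  simp [sizeLT]

open Classical in
/-- A quotient of `a` by `b` if there is one. -/
def quotient (a b : BSeries) : BSeries := if h : b ∣ a then Classical.choose h else 0

theorem quotient_mul {a b : BSeries} (h : b ∣ a) : quotient a b * b = a := by
  rw [quotient, dif_pos h, mul_comm]
  exact (Classical.choose_spec h).symm

/-- What remains of `psi` after the subtraction of suitable multiples of the localizations of the
universal factorial Schur functions of the partitions of size less than `N`. -/
def residual (psi : Partitions n → BSeries) : ℕ → Partitions n → BSeries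
  | 0 => psi
  | N + 1 => residual psi N - ∑ lam ∈ (sizeLT n (N + 1)).filter (size · = N),
      (fun _ => quotient (residual psi N lam)
        (evalAt (betaSeq lam) (universalFactorialSchur lam))) *
        localization n (universalFactorialSchur lam)

/-- The coefficients of `psi` with respect to the universal factorial Schur functions. -/
def schurCoeff (psi : Partitions n → BSeries) (lam : Partitions n) : BSeries :=
  quotient (residual psi (size lam) lam) (evalAt (betaSeq lam) (universalFactorialSchur lam))

/-- Both claims must be carried together: vanishing below size `N` and the congruences give the
divisibility at size `N`. The functions of size `N` vanish at every other partition of size at most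
`N`, so earlier zeros persist. -/
theorem residual_spec {psi : Partitions n → BSeries} (hpsi : psi ∈ gkmRing n) (N : ℕ) :
    residual psi N ∈ gkmRing n ∧ ∀ mu, size mu < N → residual psi N mu = 0 := by
  induction N with
  | zero => exact ⟨hpsi, fun mu h => absurd h (Nat.not_lt_zero _)⟩
  | succ N ih =>
    refine ⟨?_, fun mu hmu => ?_⟩
    · refine sub_mem ih.1 (sum_mem fun lam _ => mul_mem ?_
        (localization_mem_gkmRing (universalFactorialSchur_mem lam)))
      -- The coefficient enters as a constant family, for which every difference is zero.
      intro i j _ mu nu _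
      simp
    · rw [residual, Pi.sub_apply, Finset.sum_apply]
      simp only [Pi.mul_apply, localization_apply]
      rcases (Nat.lt_succ_iff.1 hmu).lt_or_eq with h | h
      · rw [ih.2 mu h, Finset.sum_eq_zero, sub_zero]
        intro lam hlam
        have := (Finset.mem_filter.1 hlam).2
        have hne : mu ≠ lam := by rintro rfl; omega
        have h0 := evalAt_universalFactorialSchur_eq_zero_of_size (by omega) hne
        rw [h0, mul_zero]
      · rw [Finset.sum_eq_single mu]
        · rw [quotient_mul, sub_self]
          exact evalAt_self_dvd ih.1 fun nu hnu => ih.2 nu (by omega)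
        · intro lam hlam hne
          have := (Finset.mem_filter.1 hlam).2
          have h0 := evalAt_universalFactorialSchur_eq_zero_of_size (by omega) hne.symm
          rw [h0, mul_zero]
        · intro hn
          exact absurd (Finset.mem_filter.2 ⟨mem_sizeLT.2 hmu, h⟩) hn

/-- The coefficient of `lam` is fixed at stage `size lam` and never revised, so the recursion
unrolls to a partial sum. -/
theorem residual_eq (psi : Partitions n → BSeries) (N : ℕ) (mu : Partitions n) :
    residual psi N mu = psi mu - ∑ lam ∈ sizeLT n N,
      schurCoeff psi lam * evalAt (betaSeq mu) (universalFactorialSchur lam) := by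
  induction N with
  | zero =>
    rw [Finset.sum_eq_zero, sub_zero]
    · rfl
    · intro lam hlam
      exact absurd (mem_sizeLT.1 hlam) (Nat.not_lt_zero _)
  | succ N ih =>
    have h1 : (sizeLT n (N + 1)).filter (fun lam => ¬ size lam = N) = sizeLT n N := by
      ext lam
      rw [Finset.mem_filter, mem_sizeLT, mem_sizeLT]
      omega
    have h2 := Finset.sum_filter_add_sum_filter_not (sizeLT n (N + 1)) (fun lam => size lam = N)
      (fun lam => schurCoeff psi lam * evalAt (betaSeq mu) (universalFactorialSchur lam))
    rw [h1] at h2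
    rw [residual, Pi.sub_apply, ih, Finset.sum_apply, sub_sub, ← h2]
    refine congrArg (psi mu - ·) ((add_comm _ _).trans (congrArg (· + _) ?_))
    refine Finset.sum_congr rfl fun lam hlam => ?_
    have := (Finset.mem_filter.1 hlam).2
    rw [Pi.mul_apply, localization_apply, schurCoeff, this]

theorem sum_schurCoeff_mul {psi : Partitions n → BSeries} (hpsi : psi ∈ gkmRing n) {N : ℕ}
    {mu : Partitions n} (hmu : size mu < N) : ∑ lam ∈ sizeLT n N,
      schurCoeff psi lam * evalAt (betaSeq mu) (universalFactorialSchur lam) = psi mu := by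
  have h := (residual_spec hpsi N).2 mu hmu
  rw [residual_eq] at h
  exact (sub_eq_zero.1 h).symm

/-! ### Injectivity of localization -/

/-- The point `x_i ↦` formal inverse of `b_{k i}` for `i ∉ s`, with the other variables fixed. -/
def partialPoint (s : Finset (Fin n)) (k : Fin n → ℕ) : Fin n ⊕ ℕ → XBSeries n :=
  Sum.elim (fun i => if i ∈ s then xVar i else formalNeg (bVar (k i))) bVar

theorem constantCoeff_partialPoint (s : Finset (Fin n)) (k : Fin n → ℕ) (t : Fin n ⊕ ℕ) :
    constantCoeff (partialPoint s k t) = 0 := by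
  rcases t with i | j
  · simp only [partialPoint, Sum.elim_inl]
    split_ifs
    · exact constantCoeff_xVar i
    · exact constantCoeff_formalNeg (constantCoeff_bVar _)
  · exact constantCoeff_bVar j

theorem hasSubst_partialPoint (s : Finset (Fin n)) (k : Fin n → ℕ) :
    HasSubst (partialPoint s k) := by
  refine ⟨fun t => by rw [constantCoeff_partialPoint]; exact IsNilpotent.zero, fun d => ?_⟩
  have h := (HasSubst.X (σ := Fin n ⊕ ℕ) (S := LazardRing)).coeff_zero d
  refine ((Set.finite_range (Sum.inl : Fin n → Fin n ⊕ ℕ)).union h).subset ?_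
  rintro (i | j) hj
  · exact Or.inl ⟨i, rfl⟩
  · exact Or.inr hj

theorem specialize_bVar (i : Fin n) {a : XBSeries n} (ha : constantCoeff a = 0) (m : ℕ) :
    specialize (Sum.inl i) ha (bVar m) = bVar m := specialize_X_of_ne ha (by simp)

theorem specialize_subst_partialPoint {s : Finset (Fin n)} {i : Fin n} (hi : i ∉ s)
    (k : Fin n → ℕ) (m : ℕ) (f : XBSeries n) :
    specialize (Sum.inl i) (constantCoeff_formalNeg (constantCoeff_bVar m))
      (f.subst (partialPoint (insert i s) k)) =
      f.subst (partialPoint s (Function.update k i m)) := by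
  rw [specialize_subst _ _ (hasSubst_partialPoint _ _)]
  congr 1
  ext1 t
  rcases t with t | t
  · simp only [partialPoint, Sum.elim_inl, Finset.mem_insert]
    by_cases hti : t = i
    · subst hti
      rw [if_pos (Or.inl rfl), if_neg hi, Function.update_self, xVar, specialize_X_self]
    · by_cases hts : t ∈ s
      · rw [if_pos (Or.inr hts), if_pos hts, xVar, specialize_X_of_ne _ (by simpa using hti)]
      · rw [if_neg (by tauto), if_neg hts, specialize_formalNeg _ _ (constantCoeff_bVar _),
          specialize_bVar, Function.update_of_ne hti]
  · exact specialize_bVar i _ t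

/-- A power series that vanishes when some `x_i` becomes the formal inverse of infinitely many
`b_m` is zero. -/
theorem eq_zero_of_specialize_eq_zero (i : Fin n) {M : Set ℕ} (hM : M.Infinite) {f : XBSeries n}
    (h : ∀ m ∈ M, specialize (Sum.inl i) (constantCoeff_formalNeg (constantCoeff_bVar m)) f = 0) :
    f = 0 := by
  rw [← order_eq_top_iff, ENat.eq_top_iff_forall_ge]
  intro N
  -- Any `N` of the zeros give a product of `N` factors without constant term dividing `f`, so `f`
  -- has order at least `N`.
  obtain ⟨S, hS, hcard⟩ := hM.exists_subset_card_eq N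
  have hd : ∏ m ∈ S, (X (Sum.inl i) - formalNeg (bVar m)) ∣ f := by
    refine prod_dvd_of_ringHom _ _ (fun m => (specialize (Sum.inl i)
        (constantCoeff_formalNeg (constantCoeff_bVar m)) : XBSeries n →+* XBSeries n))
      (fun m _ g hg => dvd_of_specialize_eq_zero _
        (constantCoeff_formalNeg (constantCoeff_bVar m)) hg) ?_ (fun m hm => h m (hS hm))
    intro m _ l _ hml
    rw [RingHom.coe_coe, map_sub, specialize_X_self,
      specialize_formalNeg _ _ (constantCoeff_bVar l), specialize_bVar]
    refine mem_nonZeroDivisors_of_associated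
      (associated_formalNeg_sub (constantCoeff_bVar m) (constantCoeff_bVar l)) ?_
    exact X_sub_X_mem_nonZeroDivisors (by simpa using hml)
  obtain ⟨g, rfl⟩ := hd
  refine le_trans ?_ ((le_self_add).trans le_order_mul)
  refine le_trans ?_ (le_order_prod _ _)
  calc (N : ℕ∞) = ∑ m ∈ S, 1 := by simp [hcard]
    _ ≤ _ := Finset.sum_le_sum fun m _ => one_le_order_iff_constCoeff_eq_zero.2 (by
      rw [map_sub, constantCoeff_X, constantCoeff_formalNeg (constantCoeff_bVar m), sub_zero])

theorem subst_partialPoint_empty (k : Fin n → ℕ) (f : XBSeries n) :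
    f.subst (partialPoint ∅ k) = bIncl n (evalAt k f) := by
  have hr : HasSubst ((X : Fin n ⊕ ℕ → XBSeries n) ∘ (Function.Embedding.inr : ℕ ↪ Fin n ⊕ ℕ)) :=
    HasSubst.X_comp _
  rw [evalAt_apply, bIncl, rename_eq_subst, subst_comp_subst_apply (hasSubst_evalPoint k) hr]
  congr 1
  ext1 t
  rcases t with t | t
  · simp only [partialPoint, evalPoint, Sum.elim_inl, Finset.notMem_empty, if_false]
    rw [subst_formalNeg hr (constantCoeff_X _), subst_X hr]
    rfl
  · simp only [partialPoint, evalPoint, Sum.elim_inr]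
    rw [subst_X hr]
    rfl

/-- The variables in `s` are freed one at a time. Once finitely many indices are used, infinitely
many remain for the next variable, so distinctness of the indices is no obstacle. -/
theorem eq_zero_of_evalAt_eq_zero {f : XBSeries n}
    (h : ∀ k : Fin n → ℕ, Function.Injective k → evalAt k f = 0) : f = 0 := by
  have key (s : Finset (Fin n)) : ∀ k : Fin n → ℕ, Set.InjOn k {i | i ∉ s} →
      f.subst (partialPoint s k) = 0 := by
    induction s using Finset.induction_on with
    | empty =>
      intro k hk
      have hk' : Function.Injective k := fun a b hab => hk (by simp) (by simp) hab
      rw [subst_partialPoint_empty, h k hk', map_zero]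
    | insert i s hi ih =>
      intro k hk
      have hM : (Set.range k)ᶜ.Infinite := (Set.finite_range k).infinite_compl
      refine eq_zero_of_specialize_eq_zero i hM fun m hm => ?_
      rw [specialize_subst_partialPoint hi]
      apply ih
      intro a ha b hb hab
      have hmk (c : Fin n) : k c ≠ m := fun hc => hm ⟨c, hc⟩
      by_cases hai : a = i <;> by_cases hbi : b = i
      · rw [hai, hbi]
      · subst hai
        rw [Function.update_self, Function.update_of_ne hbi] at hab
        exact absurd hab.symm (hmk b)
      · subst hbi
        rw [Function.update_self, Function.update_of_ne hai] at hab
        exact absurd hab (hmk a)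
      · rw [Function.update_of_ne hai, Function.update_of_ne hbi] at hab
        exact hk (by simpa [hai] using ha) (by simpa [hbi] using hb) hab
  -- With all variables free, the indices are irrelevant and injectivity is vacuous.
  have h1 := key Finset.univ (fun _ => 0) (fun a ha => absurd (Finset.mem_univ a) ha)
  have h2 : partialPoint Finset.univ (fun _ => 0) = (X : Fin n ⊕ ℕ → XBSeries n) := by
    ext1 t
    rcases t with t | t
    · simp [partialPoint, xVar]
    · rfl
  rwa [h2, subst_self] at h1

/-- The localization map is injective on symmetric series. -/
theorem eq_of_evalAt_betaSeq_eq {f g : XBSeries n} (hf : f ∈ symmetricSeries n)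
    (hg : g ∈ symmetricSeries n) (h : ∀ mu, evalAt (betaSeq mu) f = evalAt (betaSeq mu) g) :
    f = g := by
  rw [← sub_eq_zero]
  apply eq_zero_of_evalAt_eq_zero
  intro k hk
  obtain ⟨mu, w, hw⟩ := exists_partition hk
  rw [map_sub, ← evalAt_comp_of_mem k w hf, ← evalAt_comp_of_mem k w hg, ← hw, h, sub_self]

/-! ### Formal sums and the final theorems -/

theorem IsFormalSum.unique {ι σ R : Type*} [CommRing R] {f : ι → MvPowerSeries σ R}
    {F G : MvPowerSeries σ R} (hF : IsFormalSum f F) (hG : IsFormalSum f G) : F = G := by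
  ext m
  rw [(hF m).2, (hG m).2]

theorem IsFormalSum.permX {ι : Type*} {f : ι → XBSeries n} {F : XBSeries n}
    (h : IsFormalSum f F) (w : Equiv.Perm (Fin n)) :
    IsFormalSum (fun i => permX w (f i)) (permX w F) := by
  intro m
  let e := Equiv.sumCongr w (Equiv.refl ℕ)
  have hc (g : XBSeries n) : coeff m (UniversalSchur.permX w g) =
      coeff (Finsupp.embDomain e.symm.toEmbedding m) g := by
    have hm : m = Finsupp.embDomain e.toEmbedding
        (Finsupp.embDomain e.symm.toEmbedding m) := by
      rw [Finsupp.embDomain_eq_mapDomain, Finsupp.embDomain_eq_mapDomain,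
        ← Finsupp.mapDomain_comp]
      simp
    nth_rewrite 1 [hm]
    exact coeff_embDomain_rename e.toEmbedding g _
  simp_rw [hc]
  exact h _

theorem size_le_order_smul (c : BSeries) (lam : Partitions n) :
    (size lam : ℕ∞) ≤ (bIncl n c * universalFactorialSchur lam).order :=
  (size_le_order_universalFactorialSchur lam).trans (le_order_mul_left _ _)

theorem coeff_smul_eq_zero (c : BSeries) {lam : Partitions n} {m : Fin n ⊕ ℕ →₀ ℕ}
    (h : m.degree < size lam) : coeff m (bIncl n c * universalFactorialSchur lam) = 0 :=
  coeff_of_lt_order (lt_of_lt_of_le (by exact_mod_cast h) (size_le_order_smul c lam))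

theorem exists_isFormalSum (c : Partitions n → BSeries) : ∃ F ∈ symmetricSeries n,
    IsFormalSum (fun lam => bIncl n (c lam) * universalFactorialSchur lam) F := by
  let F : XBSeries n := fun m => ∑ᶠ lam, coeff m (bIncl n (c lam) * universalFactorialSchur lam)
  have hF : IsFormalSum (fun lam => bIncl n (c lam) * universalFactorialSchur lam) F := by
    intro m
    refine ⟨(finite_size_lt n (m.degree + 1)).subset fun lam hlam => ?_, rfl⟩
    by_contra hn
    exact hlam (coeff_smul_eq_zero _ (by simpa [Nat.succ_le_iff] using hn))
  refine ⟨F, fun w => ?_, hF⟩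
  have h := hF.permX w
  simp_rw [map_mul, permX_bIncl, universalFactorialSchur_mem _ w] at h
  exact h.unique hF

/-- Evaluation does not lower order, so it commutes with the infinite sum; by vanishing, only
partitions of size at most `size mu` contribute. -/
theorem evalAt_isFormalSum {c : Partitions n → BSeries} {F : XBSeries n}
    (hF : IsFormalSum (fun lam => bIncl n (c lam) * universalFactorialSchur lam) F)
    (mu : Partitions n) : evalAt (betaSeq mu) F = ∑ lam ∈ sizeLT n (size mu + 1),
      c lam * evalAt (betaSeq mu) (universalFactorialSchur lam) := by
  rw [← sub_eq_zero, ← order_eq_top_iff, ENat.eq_top_iff_forall_ge]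
  intro N
  -- The shift by `size mu + 1` keeps every term that can be nonzero at `mu` inside the truncation,
  -- for each `N`.
  have h1 : ((N + (size mu + 1) : ℕ) : ℕ∞) ≤ (F - ∑ lam ∈ sizeLT n (N + (size mu + 1)),
      bIncl n (c lam) * universalFactorialSchur lam).order := by
    apply nat_le_order
    intro d hd
    rw [map_sub, (hF d).2, map_sum, sub_eq_zero]
    apply finsum_eq_sum_of_support_subset
    intro lam hlam
    rw [Finset.mem_coe, mem_sizeLT]
    by_contra! hn
    exact hlam (coeff_smul_eq_zero _ (hd.trans_le hn))
  have h2 := h1.trans (order_le_order_evalAt (betaSeq mu) _)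
  have h3 : evalAt (betaSeq mu) (∑ lam ∈ sizeLT n (N + (size mu + 1)),
      bIncl n (c lam) * universalFactorialSchur lam) = ∑ lam ∈ sizeLT n (size mu + 1),
      c lam * evalAt (betaSeq mu) (universalFactorialSchur lam) := by
    rw [map_sum]
    simp_rw [map_mul, evalAt_bIncl]
    symm
    apply Finset.sum_subset
    · intro lam hlam
      rw [mem_sizeLT] at hlam ⊢
      omega
    · intro lam _ hlam
      rw [mem_sizeLT] at hlam
      rw [evalAt_universalFactorialSchur_eq_zero_of_size (by omega), mul_zero]
      rintro rfl
      omega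
  rw [map_sub, h3] at h2
  exact le_trans (by exact_mod_cast Nat.le_add_right _ _) h2

/-- Evaluation at `mu` gives a system triangular in size; its diagonal entries are regular, so the
coefficients can be compared one size at a time. -/
theorem isFormalSum_injective {c c' : Partitions n → BSeries} {F : XBSeries n}
    (h : IsFormalSum (fun lam => bIncl n (c lam) * universalFactorialSchur lam) F)
    (h' : IsFormalSum (fun lam => bIncl n (c' lam) * universalFactorialSchur lam) F) :
    c = c' := by
  suffices ∀ N, ∀ mu : Partitions n, size mu = N → c mu = c' mu from
    funext fun mu => this _ mu rfl
  intro N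
  induction N using Nat.strong_induction_on with
  | _ N ih =>
    intro mu hmu
    have h1 := (evalAt_isFormalSum h mu).symm.trans (evalAt_isFormalSum h' mu)
    rw [← sub_eq_zero, ← Finset.sum_sub_distrib, Finset.sum_eq_single mu, ← sub_mul,
      mul_right_mem_nonZeroDivisors_eq_zero_iff (evalAt_self_mem_nonZeroDivisors mu),
      sub_eq_zero] at h1
    · exact h1
    · intro lam hlam hne
      rw [mem_sizeLT] at hlam
      rcases (Nat.lt_succ_iff.1 hlam).lt_or_eq with h2 | h2
      · rw [ih (size lam) (by omega) lam rfl, sub_self]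
      · rw [evalAt_universalFactorialSchur_eq_zero_of_size h2.ge hne.symm, mul_zero, mul_zero,
          sub_zero]
    · intro hn
      exact absurd (mem_sizeLT.2 (Nat.lt_succ_self _)) hn

/-- Every family in the GKM ring is the localization of a formal combination of universal
factorial Schur functions. -/
theorem exists_isFormalSum_localization {psi : Partitions n → BSeries} (hpsi : psi ∈ gkmRing n) :
    ∃ (c : Partitions n → BSeries), ∃ F ∈ symmetricSeries n,
      IsFormalSum (fun lam => bIncl n (c lam) * universalFactorialSchur lam) F ∧
        localization n F = psi := by
  obtain ⟨F, hF, hsum⟩ := exists_isFormalSum (schurCoeff psi)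
  refine ⟨schurCoeff psi, F, hF, hsum, ?_⟩
  ext1 mu
  rw [localization_apply, evalAt_isFormalSum hsum,
    sum_schurCoeff_mul hpsi (Nat.lt_succ_self _)]

/-- The basis theorem for universal factorial Schur functions. -/
theorem isFormalBasis_universalFactorialSchur :
    IsFormalBasis n (fun lam : Partitions n => universalFactorialSchur lam) where
  mem := universalFactorialSchur_mem
  summable := exists_isFormalSum
  existsUnique F hF := by
    -- The expansion is found on the GKM side and carried back by injectivity of localization.
    obtain ⟨c, G, hG, hsum, hloc⟩ :=
      exists_isFormalSum_localization (localization_mem_gkmRing hF)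
    have hFG : G = F := eq_of_evalAt_betaSeq_eq hG hF fun mu => congrFun hloc mu
    subst hFG
    exact ⟨c, hsum, fun c' hc' => isFormalSum_injective hc' hsum⟩

theorem localization_image_symmetricSeries :
    localization n '' (symmetricSeries n : Set (XBSeries n)) =
      (gkmRing n : Set (Partitions n → BSeries)) := by
  ext psi
  constructor
  · rintro ⟨F, hF, rfl⟩
    exact localization_mem_gkmRing hF
  · intro hpsi
    obtain ⟨_, F, hF, -, hloc⟩ := exists_isFormalSum_localization hpsi
    exact ⟨F, hF, hloc⟩

theorem formalAdd_formalNeg_mem_nonZeroDivisors {i j : Fin n} (hij : i ≠ j) :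
    formalAdd (xVar i) (formalNeg (xVar j)) ∈ nonZeroDivisors (XBSeries n) :=
  mem_nonZeroDivisors_of_associated
    (associated_formalAdd_formalNeg (constantCoeff_xVar i) (constantCoeff_xVar j))
    (X_sub_X_mem_nonZeroDivisors (by simpa using hij))

end UniversalSchur

end

open UniversalSchur in
theorem mainTheorem12 (n : ℕ) :
    -- the fractions and their sum are well defined, and the sum is a power series
    (∀ i j : Fin n, i ≠ j →
      formalAdd (xVar i) (formalNeg (xVar j)) ∈ nonZeroDivisors (XBSeries n)) ∧
    (∀ lam : Partitions n,
      algebraMap (XBSeries n) (FractionRing (XBSeries n)) (universalFactorialSchur lam) =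
        schurFraction lam) ∧
    -- the basis theorem
    IsFormalBasis n (fun lam : Partitions n => universalFactorialSchur lam) ∧
    -- the algebraic localization map is onto the GKM ring
    localization n '' (symmetricSeries n : Set (XBSeries n)) =
      (gkmRing n : Set (Partitions n → BSeries)) := by
  exact ⟨fun i j hij => formalAdd_formalNeg_mem_nonZeroDivisors hij,
    algebraMap_universalFactorialSchur, isFormalBasis_universalFactorialSchur,
    localization_image_symmetricSeries⟩
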